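/- Let $L$ be an even lattice (of full rank) in a finite-dimensional non-degenerate rational quadratic space $(V,(\,,))$ of signature $(p,q)$; put $q(x)=\tfrac12(x,x)$, let $L^\#$ be the dual lattice, $\mathfrak e_h$ ($h\in L^\#/L$) the standard basis of $\mathbb C[L^\#/L]$, and $e(z)=e^{2\pi i z}$. Let $\Gamma'=\mathrm{Mp}_2(\mathbb Z)$ be the group of pairs $(\gamma,\phi)$ with $\gamma=\left(\begin{smallmatrix}a&b\\c&d\end{smallmatrix}\right)\in\mathrm{SL}_2(\mathbb Z)$ and $\phi$ holomorphic on $\mathbb H$ with $\phi(\tau)^2=c\tau+d$, and let $\varrho_L$ be the (Weil) representation of $\Gamma'$ on $\mathbb C[L^\#/L]$ given on the generators $T=\left(\left(\begin{smallmatrix}1&1\\0&1\end{smallmatrix}\right),1\right)$ and $S=\left(\left(\begin{smallmatrix}0&-1\\1&0\end{smallmatrix}\right),\sqrt\tau\right)$ by $$\varrho_L(T)\mathfrak e_h=e(q(h))\mathfrak e_h,\qquad \varrho_L(S)\mathfrak e_h=\frac{\sqrt i^{\,q-p}}{\sqrt{|L^\#/L|}}\sum_{h'\in L^\#/L}e(-(h,h'))\mathfrak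 e_{h'} .$$ Let $L^-$ be $L$ with the form $-(\,,)$, so that $\varrho_{L^-}=\overline{\varrho_L}$ on the same space. Let $k\in\frac12\mathbb Z$, $k\ne1$, $\kappa=2-k$, and write $\tau=u+iv\in\mathbb H$. A function $f:\mathbb H\to\mathbb C[L^\#/L]$ has weight $k$ for $\varrho_L$ if $f(\gamma\tau)=\phi(\tau)^{2k}\varrho_L(\gamma,\phi)f(\tau)$ for all $(\gamma,\phi)\in\Gamma'$. $M_{k,L}$ (resp. $S_{k,L}$) is the space of holomorphic functions of weight $k$ for $\varrho_L$ that are bounded (resp. tend to $0$) as $v\to\infty$. $H_{k,L}$ is the space of twice continuously differentiable $f$ of weight $k$ for $\varrho_L$ with $f(\tau)=O(e^{Cv})$ as $v\to\infty$, uniformly in $u$, for some $C>0$, and $\Delta_kf=0$, where $\Delta_k=-v^2(\partial_u^2+\partial_v^2)+ikv(\partial_u+i\partial_v)$. Put $L_k=-2iv^2\frac{\partial}{\partial\bar\tau}$, $\xi_k(f)=v^{k-2}\overline{L_kf}$ and $H^+_{k,L}=\{f\in H_{k,L}:\ \xi_k(f)\in S_{2-k,L^-}\}$. For $g\in M_{\kappa,L^-}$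 and $f\in H^+_{k,L}$ let $$\{g,f\}=(g,\xi_k(f))_{\kappa,L^-}=\int_{\Gamma'\backslash\mathbb H}\langle g,\xi_k(f)\rangle\,v^{\kappa}\,\frac{du\,dv}{v^2},$$ with $\langle\,,\rangle$ the standard Hermitian product on $\mathbb C[L^\#/L]$, antilinear in the second variable. **Proposition.** Let $g\in M_{\kappa,L^-}$ and $f\in H^+_{k,L}$. Then $g$ and $f$ have absolutely convergent Fourier expansions $$g=\sum_{h}\sum_{n\in\mathbb Q}b(h,n)e(n\tau)\mathfrak e_h,$$ $$f=\sum_h\sum_{n\in\mathbb Q}a^+(h,n)e(n\tau)\mathfrak e_h+\sum_h\Big(a^-(h,0)v^{1-k}+\sum_{n\neq0}a^-(h,n)H(2\pi nv)e(nu)\Big)\mathfrak e_h,$$ where $b(h,n)=0$ unless $n+q(h)\in\mathbb Z$, $a^\pm(h,n)=0$ unless $n-q(h)\in\mathbb Z$, and $H(w)=e^{-w}\int_{-2w}^\infty e^{-t}t^{-k}\,dt$ (for $w>0$ continued holomorphically in $k$ from $k<1$, with $t^{-k}$ the principal branch). For every such pair of expansions the principal part $\sum_h\sum_{n\le0}a^+(h,n)e(n\tau)\mathfrak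 e_h$ of $f$ is a finite sum, the integral defining $\{g,f\}$ converges absolutely, and $$\{g,f\}=\sum_{h\in L^\#/L}\ \sum_{n\le0}a^+(h,n)\,b(h,-n).$$ In particular $\{g,f\}$ is determined by the principal part of $f$: if $f'\in H^+_{k,L}$ has an expansion with the same coefficients $a^+(h,n)$ for all $n\le0$, then $\{g,f'\}=\{g,f\}$. -/

import Mathlib

open UpperHalfPlane MeasureTheory Asymptotics
open scoped Modular MatrixGroups Manifold ComplexConjugate

noncomputable section

/-! ### Even lattices, dual lattices and discriminant groups -/

/-- An even lattice `carrier` of full rank in a finite-dimensional non-degenerate rational quadratic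
space `(V, form)`. The dual lattice is recorded as a field (determined by `dual_eq`), so that
`L` and `L⁻` have literally the same discriminant group. -/
structure EvenLattice (V : Type*) [AddCommGroup V] [Module ℚ V] where
  form : LinearMap.BilinForm ℚ V
  symm : form.IsSymm
  nondeg : form.Nondegenerate
  carrier : Submodule ℤ V
  fg : carrier.FG
  span_eq_top : Submodule.span ℚ (carrier : Set V) = ⊤
  even : ∀ x ∈ carrier, ∃ n : ℤ, form x x = 2 * n
  dual : Submodule ℤ V
  dual_eq : dual = form.dualSubmodule carrier

namespace EvenLattice

variable {V : Type*} [AddCommGroup V] [Module ℚ V]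

theorem dualSubmodule_neg (B : LinearMap.BilinForm ℚ V) (N : Submodule ℤ V) :
    (-B).dualSubmodule N = B.dualSubmodule N := by
  ext x
  simp [LinearMap.BilinForm.mem_dualSubmodule]

/-- The lattice `L⁻`: the same module with the form `-( , )`. -/
abbrev neg (L : EvenLattice V) : EvenLattice V where
  form := -L.form
  symm := ⟨fun x y => by simpa using L.symm.eq x y⟩
  nondeg := by
    have h := L.nondeg
    refine ⟨fun x hx => h.1 x fun y => ?_, fun y hy => h.2 y fun x => ?_⟩
    · simpa using hx y
    · simpa using hy x
  carrier := L.carrier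
  fg := L.fg
  span_eq_top := L.span_eq_top
  even := fun x hx => by
    obtain ⟨n, hn⟩ := L.even x hx
    exact ⟨-n, by simp [hn]⟩
  dual := L.dual
  dual_eq := by rw [dualSubmodule_neg, L.dual_eq]

/-- The discriminant group `L^# / L`. -/
abbrev Disc (L : EvenLattice V) : Type _ := L.dual ⧸ L.carrier.submoduleOf L.dual

theorem finiteDimensional (L : EvenLattice V) : FiniteDimensional ℚ V := by
  obtain ⟨S, hS⟩ := L.fg
  refine ⟨⟨S, ?_⟩⟩
  have h := L.span_eq_top
  rwa [← hS, Submodule.span_span_of_tower] at h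

theorem fg_dual (L : EvenLattice V) : L.dual.FG := by
  classical
  have := L.finiteDimensional
  let b := Module.Basis.ofSpan L.span_eq_top.ge
  have : Finite (linearIndepOn_empty ℚ (id : V → V) |>.extend (Set.empty_subset
      (L.carrier : Set V))) := Module.Finite.finite_basis b
  have hb : Submodule.span ℤ (Set.range b) ≤ L.carrier := by
    rw [Submodule.span_le]
    exact Module.Basis.ofSpan_subset L.span_eq_top.ge
  have hle : L.dual ≤ L.form.dualSubmodule (Submodule.span ℤ (Set.range b)) := by
    rw [L.dual_eq]
    exact fun x hx y hy => hx y (hb hy)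
  rw [LinearMap.BilinForm.dualSubmodule_span_of_basis _ L.nondeg] at hle
  have : IsNoetherian ℤ (Submodule.span ℤ (Set.range (L.form.dualBasis L.nondeg b))) :=
    isNoetherian_span_of_finite ℤ (Set.finite_range _)
  exact Submodule.FG.of_le (Submodule.fg_span (Set.finite_range _)) hle

theorem exists_smul_mem (L : EvenLattice V) (x : V) : ∃ n : ℤ, n ≠ 0 ∧ n • x ∈ L.carrier := by
  have hx : x ∈ Submodule.span ℚ (L.carrier : Set V) := L.span_eq_top ▸ Submodule.mem_top
  induction hx using Submodule.span_induction with
  | mem x hx => exact ⟨1, one_ne_zero, by simpa using hx⟩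
  | zero => exact ⟨1, one_ne_zero, by simp⟩
  | add x y _ _ hx hy =>
    obtain ⟨a, ha, hax⟩ := hx
    obtain ⟨c, hc, hcy⟩ := hy
    refine ⟨a * c, mul_ne_zero ha hc, ?_⟩
    rw [smul_add]
    refine add_mem ?_ ?_
    · rw [mul_comm, mul_smul]; exact L.carrier.smul_mem c hax
    · rw [mul_smul]; exact L.carrier.smul_mem a hcy
  | smul r x _ hx =>
    obtain ⟨a, ha, hax⟩ := hx
    refine ⟨a * r.den, mul_ne_zero ha (by exact_mod_cast r.den_ne_zero), ?_⟩
    have : (a * r.den : ℤ) • r • x = r.num • a • x := by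
      simp only [← Int.cast_smul_eq_zsmul ℚ, smul_smul]
      congr 1
      push_cast
      rw [mul_assoc, Rat.den_mul_eq_num, mul_comm]
    rw [this]
    exact L.carrier.smul_mem _ hax

instance finite_disc (L : EvenLattice V) : Finite L.Disc := by
  have : Module.Finite ℤ L.dual := Module.Finite.iff_fg.mpr L.fg_dual
  refine Module.finite_of_fg_torsion _ fun {h} => ?_
  induction h using Submodule.Quotient.induction_on with
  | _ x =>
    obtain ⟨n, hn, hx⟩ := L.exists_smul_mem x
    refine ⟨⟨n, mem_nonZeroDivisors_of_ne_zero hn⟩, ?_⟩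
    change n • (Submodule.Quotient.mk x : L.Disc) = 0
    rw [← Submodule.Quotient.mk_smul, Submodule.Quotient.mk_eq_zero]
    exact hx

instance fintypeDisc (L : EvenLattice V) : Fintype L.Disc := Fintype.ofFinite _

instance decidableEqDisc (L : EvenLattice V) : DecidableEq L.Disc := Classical.decEq _

/-- `p - q`, where `(p, q)` is the signature of `(V, form)`. -/
def sig (L : EvenLattice V) : ℤ := (sigPos L.form.toQuadraticMap : ℤ) - (sigNeg L.form.toQuadraticMap : ℤ)

/-- A representative of `(h, h')` for `h, h'` in `L^#/L`; only its class modulo `ℤ` is canonical. -/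
def bilin (L : EvenLattice V) (h h' : L.Disc) : ℚ := L.form (Quotient.out h : L.dual) (Quotient.out h' : L.dual)

/-- A representative of `q(h) = (h, h) / 2`; only its class modulo `ℤ` is canonical. -/
def quad (L : EvenLattice V) (h : L.Disc) : ℚ := L.bilin h h / 2

end EvenLattice

/-! ### The metaplectic cover of the modular group and the Weil representation -/

/-- `e(z) = exp(2πiz)`. -/
def cexp1 (z : ℂ) : ℂ := Complex.exp (2 * Real.pi * Complex.I * z)

/-- The group `Γ' = Mp₂(ℤ)`: pairs `(γ, φ)` with `γ ∈ SL₂(ℤ)` and `φ` a holomorphic function on `ℍ`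
with `φ(τ)² = cτ + d`. -/
structure Mp2Z where
  mat : SL(2, ℤ)
  phi : ℍ → ℂ
  holo : MDifferentiable 𝓘(ℂ) 𝓘(ℂ) phi
  sq : ∀ τ : ℍ, phi τ ^ 2 = (mat 1 0 : ℂ) * τ + (mat 1 1 : ℂ)

namespace Mp2Z

/-- `(γ₁, φ₁(τ)) (γ₂, φ₂(τ)) = (γ₁γ₂, φ₁(γ₂τ) φ₂(τ))`. -/
instance : Mul Mp2Z where
  mul x y :=
    { mat := x.mat * y.mat
      phi := fun τ => x.phi (y.mat • τ) * y.phi τ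
      holo := by
        have h : MDifferentiable 𝓘(ℂ) 𝓘(ℂ) (fun τ : ℍ => y.mat • τ) :=
          UpperHalfPlane.mdifferentiable_smul (g := (y.mat : GL (Fin 2) ℝ)) (by simp)
        exact (x.holo.comp h).mul y.holo
      sq := fun τ => by
        have h0 : (y.mat 1 0 : ℂ) * τ + (y.mat 1 1 : ℂ) ≠ 0 := by
          have h := UpperHalfPlane.denom_ne_zero (y.mat : GL (Fin 2) ℝ) τ
          simpa [UpperHalfPlane.denom, -UpperHalfPlane.denom_ne_zero] using h
        rw [mul_pow, x.sq, y.sq, UpperHalfPlane.coe_specialLinearGroup_apply]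
        simp only [algebraMap_int_eq, eq_intCast, Complex.ofReal_intCast,
          Matrix.SpecialLinearGroup.coe_mul, Matrix.mul_apply, Fin.sum_univ_two]
        push_cast
        rw [add_mul, mul_assoc, div_mul_cancel₀ _ h0]
        ring }

/-- `T = ((1, 1; 0, 1), 1)`. -/
def T : Mp2Z where
  mat := ModularGroup.T
  phi := fun _ => 1
  holo := mdifferentiable_const
  sq := fun τ => by simp [ModularGroup.T]

/-- `S = ((0, -1; 1, 0), √τ)`, with the principal branch of the square root. -/
def S : Mp2Z where
  mat := ModularGroup.S
  phi := fun τ => (τ : ℂ) ^ (1 / 2 : ℂ)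
  holo := by
    intro τ
    have h : DifferentiableAt ℂ (fun z : ℂ => z ^ (1 / 2 : ℂ)) (τ : ℂ) :=
      differentiableAt_id.cpow_const (Or.inr τ.im_ne_zero)
    exact h.mdifferentiableAt.comp τ (UpperHalfPlane.mdifferentiable_coe τ)
  sq := fun τ => by
    rw [← Complex.cpow_nat_mul]
    simp [ModularGroup.S]

end Mp2Z

namespace EvenLattice

variable {V : Type*} [AddCommGroup V] [Module ℚ V]

/-- `ϱ_L(T) 𝔢_h = e(q(h)) 𝔢_h`, as a matrix in the basis `(𝔢_h)` of `ℂ[L^#/L]`. -/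
def weilT (L : EvenLattice V) : Matrix L.Disc L.Disc ℂ :=
  Matrix.diagonal fun h => cexp1 (L.quad h)

/-- `ϱ_L(S) 𝔢_h = √i^(q-p) / √|L^#/L| * ∑_{h'} e(-(h, h')) 𝔢_{h'}`, as a matrix. -/
def weilS (L : EvenLattice V) : Matrix L.Disc L.Disc ℂ :=
  Matrix.of fun h h' => Complex.exp (Real.pi * Complex.I / 4) ^ (-L.sig) /
    (Real.sqrt (Fintype.card L.Disc) : ℂ) * cexp1 (-(L.bilin h h' : ℂ))

/-- `IsWeil L γ M` says `ϱ_L(γ) = M`, where `ϱ_L` is the representation of `Γ' = Mp₂(ℤ)` on `ℂ[L^#/L]`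
determined by its values on the generators `S` and `T`. Since `S` and `ST` have finite order in
`Γ'`, every element of `Γ'` is a product of copies of `S` and `T`. -/
inductive IsWeil (L : EvenLattice V) : Mp2Z → Matrix L.Disc L.Disc ℂ → Prop
  | T : IsWeil L Mp2Z.T L.weilT
  | S : IsWeil L Mp2Z.S L.weilS
  | mul {γ₁ γ₂ : Mp2Z} {M₁ M₂ : Matrix L.Disc L.Disc ℂ} :
      IsWeil L γ₁ M₁ → IsWeil L γ₂ M₂ → IsWeil L (γ₁ * γ₂) (M₁ * M₂)

/-- `f(γτ) = φ(τ)^m ϱ_L(γ, φ) f(τ)` for all `(γ, φ) ∈ Γ'`; the weight is `k = m / 2`. -/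
def IsAutomorphic (L : EvenLattice V) (m : ℤ) (f : ℍ → L.Disc → ℂ) : Prop :=
  ∀ (γ : Mp2Z) (M : Matrix L.Disc L.Disc ℂ), IsWeil L γ M →
    ∀ τ : ℍ, f (γ.mat • τ) = γ.phi τ ^ m • M.mulVec (f τ)

end EvenLattice

/-! ### Differential operators on the upper half plane -/

section Operators

variable {E : Type*} [NormedAddCommGroup E] [NormedSpace ℂ E]

/-- `∂f/∂u`, where `τ = u + iv`. -/
def partialU (f : ℍ → E) (τ : ℍ) : E := fderiv ℝ (f ∘ ofComplex) (τ : ℂ) 1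

/-- `∂f/∂v`, where `τ = u + iv`. -/
def partialV (f : ℍ → E) (τ : ℍ) : E := fderiv ℝ (f ∘ ofComplex) (τ : ℂ) Complex.I

/-- `Δ_k = -v² (∂²/∂u² + ∂²/∂v²) + ikv (∂/∂u + i ∂/∂v)`. -/
def hypLaplacian (k : ℝ) (f : ℍ → E) (τ : ℍ) : E :=
  -((τ.im : ℂ) ^ 2 • (partialU (partialU f) τ + partialV (partialV f) τ)) +
    (Complex.I * k * τ.im) • (partialU f τ + Complex.I • partialV f τ)

/-- The lowering operator `-2i v² ∂/∂τ̄`, where `∂/∂τ̄ = (∂/∂u + i ∂/∂v) / 2`. -/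
def lowering (f : ℍ → E) (τ : ℍ) : E :=
  (-2 * Complex.I * (τ.im : ℂ) ^ 2) • ((1 / 2 : ℂ) • (partialU f τ + Complex.I • partialV f τ))

end Operators

/-- `ξ_k(f) = v^(k-2) * conj (L_k f)`, where the conjugation is taken in each component. -/
def xiOp {A : Type*} [Fintype A] (k : ℝ) (f : ℍ → A → ℂ) (τ : ℍ) (h : A) : ℂ :=
  ((τ.im ^ (k - 2) : ℝ) : ℂ) * conj (lowering f τ h)

/-! ### Spaces of vector valued modular forms for `Γ'` -/

namespace EvenLattice

variable {V : Type*} [AddCommGroup V] [Module ℚ V]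

/-- Holomorphic modular forms `M_{k,L}` of weight `k = m / 2`. -/
structure IsModularForm (L : EvenLattice V) (m : ℤ) (g : ℍ → L.Disc → ℂ) : Prop where
  holo : MDifferentiable 𝓘(ℂ) 𝓘(ℂ, L.Disc → ℂ) g
  automorphic : L.IsAutomorphic m g
  bounded : IsBoundedAtImInfty g

/-- Cusp forms `S_{k,L}` of weight `k = m / 2`. -/
structure IsCuspForm (L : EvenLattice V) (m : ℤ) (g : ℍ → L.Disc → ℂ) : Prop where
  holo : MDifferentiable 𝓘(ℂ) 𝓘(ℂ, L.Disc → ℂ) g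
  automorphic : L.IsAutomorphic m g
  zero_at_infty : IsZeroAtImInfty g

/-- Weak Maass forms `H_{k,L}` of weight `k = m / 2` for the full group `Γ'` (which has only
one class of cusps). -/
structure IsWeakMaassForm (L : EvenLattice V) (m : ℤ) (f : ℍ → L.Disc → ℂ) : Prop where
  contDiff : ContDiffOn ℝ 2 (f ∘ ofComplex) {z : ℂ | 0 < z.im}
  automorphic : L.IsAutomorphic m f
  growth : ∃ C : ℝ, 0 < C ∧ f =O[atImInfty] fun τ => Real.exp (C * τ.im)
  harmonic : ∀ τ, hypLaplacian ((m : ℝ) / 2) f τ = 0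

/-- The space `H⁺_{k,L}`, `k = m / 2`: the inverse image of `S_{2-k,L⁻}` under `ξ_k`. -/
structure IsHPlus (L : EvenLattice V) (m : ℤ) (f : ℍ → L.Disc → ℂ) : Prop where
  weakMaass : L.IsWeakMaassForm m f
  cusp : L.neg.IsCuspForm (4 - m) (xiOp ((m : ℝ) / 2) f)

end EvenLattice

/-! ### Fourier expansions -/

/-- `H(w) = e^(-w) ∫_{-2w}^∞ e^(-t) t^(-k) dt` for `w ≠ 0`. For `w > 0` the path of integration avoids
the origin along the upper half circle from `-2w` to `2w`; this gives the holomorphic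
continuation in `k` of the integral along the real line, which converges only for `k < 1`. -/
def maassH (k w : ℝ) : ℂ :=
  (Real.exp (-w) : ℂ) * (((∫ t in Set.Ioi (2 * |w|), Real.exp (-t) * t ^ (-k) : ℝ) : ℂ) -
    if 0 < w then
      ∫ θ in (0 : ℝ)..Real.pi, Complex.exp (-(2 * w * Complex.exp (Complex.I * θ))) *
        (2 * w * Complex.exp (Complex.I * θ)) ^ (-k : ℂ) *
        (Complex.I * (2 * w * Complex.exp (Complex.I * θ)))
    else 0)

/-- The function multiplied by `a⁻(h,n)` in the expansion of `f⁻`: `v^(1-k)` if `n = 0`, and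
`H(2πnv) e(nu)` if `n ≠ 0`. -/
def minusTerm (k : ℝ) (n : ℚ) (τ : ℍ) : ℂ :=
  if n = 0 then ((τ.im ^ (1 - k) : ℝ) : ℂ)
  else maassH k (2 * Real.pi * n * τ.im) * cexp1 ((n : ℂ) * (τ.re : ℂ))

namespace EvenLattice

variable {V : Type*} [AddCommGroup V] [Module ℚ V]

/-- `g = ∑_h ∑_n b(h,n) e(nτ) 𝔢_h`, with `b(h,n) = 0` unless `n - q(h) ∈ ℤ`. -/
structure IsFourierExpansion (L : EvenLattice V) (g : ℍ → L.Disc → ℂ)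
    (b : L.Disc → ℚ → ℂ) : Prop where
  support : ∀ h n, b h n ≠ 0 → ∃ j : ℤ, n - L.quad h = j
  hasSum : ∀ (τ : ℍ) h, HasSum (fun n : ℚ => b h n * cexp1 ((n : ℂ) * (τ : ℂ))) (g τ h)

/-- `f = f⁺ + f⁻` with `f⁺ = ∑_h ∑_n a⁺(h,n) e(nτ) 𝔢_h` and
`f⁻ = ∑_h (a⁻(h,0) v^(1-k) + ∑_{n ≠ 0} a⁻(h,n) H(2πnv) e(nu)) 𝔢_h`, where `a^±(h,n) = 0` unless
`n - q(h) ∈ ℤ`, and both series converge absolutely. -/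
structure IsMaassExpansion (L : EvenLattice V) (k : ℝ) (f : ℍ → L.Disc → ℂ)
    (ap am : L.Disc → ℚ → ℂ) : Prop where
  support_plus : ∀ h n, ap h n ≠ 0 → ∃ j : ℤ, n - L.quad h = j
  support_minus : ∀ h n, am h n ≠ 0 → ∃ j : ℤ, n - L.quad h = j
  summable_plus : ∀ (τ : ℍ) h, Summable fun n : ℚ => ap h n * cexp1 ((n : ℂ) * (τ : ℂ))
  summable_minus : ∀ (τ : ℍ) h, Summable fun n : ℚ => am h n * minusTerm k n τ
  eq_add : ∀ (τ : ℍ) h, f τ h =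
    (∑' n : ℚ, ap h n * cexp1 ((n : ℂ) * (τ : ℂ))) + ∑' n : ℚ, am h n * minusTerm k n τ

end EvenLattice

/-! ### The Petersson product and the pairing -/

section Pairing

variable {A : Type*} [Fintype A]

/-- The integrand `⟨g₁, g₂⟩ v^κ` of the Petersson scalar product, with `⟨ , ⟩` the standard scalar
product, antilinear in the second variable. -/
def peterssonIntegrand (κ : ℝ) (g₁ g₂ : ℍ → A → ℂ) (τ : ℍ) : ℂ :=
  (∑ h, g₁ τ h * conj (g₂ τ h)) * ((τ.im ^ κ : ℝ) : ℂ)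

/-- `(g₁, g₂)_κ = ∫_{Γ' \ ℍ} ⟨g₁, g₂⟩ v^κ dμ` with `dμ = du dv / v²` (which is `volume` on `ℍ`), the integral
being taken over the standard fundamental domain `{|τ| ≥ 1, |u| ≤ 1/2}`. -/
def peterssonProduct (κ : ℝ) (g₁ g₂ : ℍ → A → ℂ) : ℂ :=
  ∫ τ in 𝒟, peterssonIntegrand κ g₁ g₂ τ

/-- The pairing `{g, f} = (g, ξ_k(f))_κ` with `κ = 2 - k`. -/
def maassPairing (k : ℝ) (g f : ℍ → A → ℂ) : ℂ :=
  peterssonProduct (2 - k) g (xiOp k f)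

end Pairing

end

/-!
Write `k = m / 2`. The proof uses `f` only through its components, which all satisfy the first-order
equation `∂f_h/∂u + i ∂f_h/∂v = i v^{-k} \overline{G_h}` with `G = ξ_k f` a cusp form, and through
its transformation under `T` and `S`.

*Fourier expansions.* A component `φ` of `f` satisfies `φ(τ + 1) = e(q) φ(τ)`, so on each horizontal
line it has Fourier coefficients `c_n(v)`, `n ∈ q + ℤ`. Green's formula for `φ(z) e(-nz)` on a
rectangle (`IsHPlusComponent.exp_mul_horizontalCoeff_sub`) gives `e^{2πnv} c_n(v)` up to a constant
as an integral over `v` of the `(-n)`-th coefficient of `G`, that is as an incomplete Gamma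
function. As `G` is a cusp form, only `n < 0` contributes, where `H(2πnv)` is an ordinary convergent
integral; this is `IsHPlusComponent.exists_isMaassSeries`. For any expansion and any `n < 0` the
Gamma function decays, so `e^{2πnv} c_n(v)` tends to `a⁺(h, n)`, and the growth condition on `f`
leaves only finitely many terms with `n ≤ 0`.

*Stokes' theorem.* By `S` and `T` the function `F = ∑_h g_h f_h` transforms like a modular form of
weight `2`, since `ϱ_{L⁻}` is the conjugate of the unitary representation `ϱ_L`, and `∂F/∂τ̄` is the
integrand of the pairing up to a constant. Hence the integral over the fundamental domain truncated
at height `T` is `∫ F(u + iT) du` over `-1/2 ≤ u ≤ 1/2`: the vertical sides cancel by periodicity,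
and the arc contributes nothing because `z ↦ -1/z` reverses it while preserving `F dz`
(`integral_truncated_fundamentalDomain`).

*The limit `T → ∞`.* The horizontal integral is the constant term of `∑_h g_h f_h`: the holomorphic
part of `f` gives `∑_{n ≤ 0} a⁺(h, n) b(h, -n)` for every `T`, and the contribution of the remaining
part tends to `0` (`tendsto_integral_mul`). The left-hand side tends to the pairing because `g` is
bounded and `G` decays exponentially, so that the integrand is absolutely integrable. Combining these
gives `EvenLattice.maassPairing_eq`.
-/

/-! ### Exponentials and Fourier series -/

lemma cexp1_add (z w : ℂ) : cexp1 (z + w) = cexp1 z * cexp1 w := by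
  simp only [cexp1, mul_add, Complex.exp_add]

lemma cexp1_zero : cexp1 0 = 1 := by simp [cexp1]

lemma cexp1_neg_mul_self (z : ℂ) : cexp1 (-z) * cexp1 z = 1 := by
  rw [← cexp1_add, neg_add_cancel, cexp1_zero]

lemma cexp1_intCast (n : ℤ) : cexp1 n = 1 :=
  Complex.exp_eq_one_iff.2 ⟨n, by ring⟩

lemma norm_cexp1 (z : ℂ) : ‖cexp1 z‖ = Real.exp (-(2 * Real.pi * z.im)) := by
  simp [cexp1, Complex.norm_exp]

lemma norm_cexp1_of_im_eq_zero {z : ℂ} (hz : z.im = 0) : ‖cexp1 z‖ = 1 := by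
  simp [norm_cexp1, hz]

lemma norm_cexp1_ratCast_mul_ofReal (n : ℚ) (u : ℝ) : ‖cexp1 (n * u)‖ = 1 :=
  norm_cexp1_of_im_eq_zero (by simp)

lemma conj_cexp1 (z : ℂ) : conj (cexp1 z) = cexp1 (-conj z) := by
  simp only [cexp1, ← Complex.exp_conj]
  congr 1
  simp only [map_mul, Complex.conj_ofReal, Complex.conj_I, Complex.conj_ofNat]
  ring

lemma contDiff_cexp1 : ContDiff ℂ 2 cexp1 :=
  Complex.contDiff_exp.comp (contDiff_const.mul contDiff_id)

lemma continuous_cexp1 : Continuous cexp1 := contDiff_cexp1.continuous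

lemma hasDerivAt_cexp1_mul (c z : ℂ) :
    HasDerivAt (fun z => cexp1 (c * z)) (2 * Real.pi * Complex.I * c * cexp1 (c * z)) z := by
  have h : HasDerivAt (fun z : ℂ => 2 * Real.pi * Complex.I * (c * z))
      (2 * Real.pi * Complex.I * (c * 1)) z :=
    ((hasDerivAt_id z).const_mul c).const_mul _
  convert! h.cexp using 1
  simp only [cexp1]
  ring

lemma hasDerivAt_cexp1_mul_ofReal (c : ℂ) (u : ℝ) :
    HasDerivAt (fun u : ℝ => cexp1 (c * u)) (2 * Real.pi * Complex.I * c * cexp1 (c * u)) u :=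
  (hasDerivAt_cexp1_mul c u).comp_ofReal

/-- Splitting off the height: `e(n(u + iv)) = e^{-2πnv} e(nu)`. -/
lemma cexp1_ratCast_mul (n : ℚ) (u v : ℝ) :
    cexp1 (n * (u + v * Complex.I)) = Real.exp (-(2 * Real.pi * n * v)) * cexp1 (n * u) := by
  rw [mul_add, cexp1_add, mul_comm]
  congr 1
  rw [cexp1, Complex.ofReal_exp]
  congr 1
  push_cast
  linear_combination (2 * Real.pi * n * v : ℂ) * Complex.I_mul_I

lemma cexp1_ratCast_mul_tau (n : ℚ) (τ : ℍ) :
    cexp1 (n * (τ : ℂ)) = Real.exp (-(2 * Real.pi * n * τ.im)) * cexp1 (n * τ.re) := by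
  rw [← cexp1_ratCast_mul]
  congr 2
  exact (Complex.re_add_im _).symm

lemma integral_cexp1_intCast {n : ℤ} (hn : n ≠ 0) :
    ∫ u in (-1 / 2 : ℝ)..(1 / 2), cexp1 (n * u) = 0 := by
  have hc : (2 * Real.pi * Complex.I * n : ℂ) ≠ 0 := by
    simp [Real.pi_ne_zero, hn]
  have h : ∀ u ∈ Set.uIcc (-1 / 2 : ℝ) (1 / 2), HasDerivAt
      (fun u : ℝ => (2 * Real.pi * Complex.I * n : ℂ)⁻¹ * cexp1 (n * u)) (cexp1 (n * u)) u := by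
    intro u _
    have := (hasDerivAt_cexp1_mul_ofReal n u).const_mul (2 * Real.pi * Complex.I * n : ℂ)⁻¹
    rwa [← mul_assoc, inv_mul_cancel₀ hc, one_mul] at this
  rw [intervalIntegral.integral_eq_sub_of_hasDerivAt h
    (Continuous.intervalIntegrable (continuous_cexp1.comp (by fun_prop)) _ _)]
  have : cexp1 (n * (1 / 2 : ℝ)) = cexp1 (n * (-1 / 2 : ℝ)) := by
    have : (n * (1 / 2 : ℝ) : ℂ) = n * (-1 / 2 : ℝ) + n := by push_cast; ring
    rw [this, cexp1_add, cexp1_intCast, mul_one]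
  rw [this, sub_self]

/-- Termwise integration of an absolutely convergent Fourier series against a continuous
function. -/
lemma hasSum_integral_mul_of_hasSum {s : ℚ → ℂ} (hs : Summable s) {φ ψ : ℝ → ℂ}
    (hφ : ∀ u : ℝ, HasSum (fun n : ℚ => s n * cexp1 (n * u)) (φ u)) (hψ : Continuous ψ) :
    HasSum (fun n : ℚ => s n * ∫ u in (-1 / 2 : ℝ)..(1 / 2), cexp1 (n * u) * ψ u)
      (∫ u in (-1 / 2 : ℝ)..(1 / 2), φ u * ψ u) := by
  have hc (n : ℚ) : Continuous fun u : ℝ => cexp1 (n * u) := continuous_cexp1.comp (by fun_prop)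
  have := intervalIntegral.hasSum_integral_of_dominated_convergence (μ := volume)
    (a := -1 / 2) (b := 1 / 2)
    (F := fun (n : ℚ) (u : ℝ) => s n * (cexp1 (n * u) * ψ u)) (f := fun u => φ u * ψ u)
    (fun n u => ‖s n‖ * ‖ψ u‖)
    (fun n => (continuous_const.mul ((hc n).mul hψ)).aestronglyMeasurable)
    (fun n => .of_forall fun u _ => by
      rw [norm_mul, norm_mul, norm_cexp1_ratCast_mul_ofReal, one_mul])
    (.of_forall fun u _ => hs.norm.mul_right _)
    (by
      simp_rw [tsum_mul_right]
      exact (continuous_const.mul hψ.norm).intervalIntegrable _ _)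
    (.of_forall fun u _ => by simpa only [mul_assoc] using (hφ u).mul_right (ψ u))
  simpa only [intervalIntegral.integral_const_mul] using this

/-- The coefficients of an absolutely convergent Fourier series supported on a coset `q + ℤ`. -/
lemma integral_mul_cexp1_of_hasSum {q : ℚ} {s : ℚ → ℂ} (hs : Summable s)
    (hsupp : ∀ n, s n ≠ 0 → ∃ j : ℤ, n - q = j) {φ : ℝ → ℂ}
    (hφ : ∀ u : ℝ, HasSum (fun n : ℚ => s n * cexp1 (n * u)) (φ u)) {r : ℚ}
    (hr : ∃ j : ℤ, r - q = j) :
    ∫ u in (-1 / 2 : ℝ)..(1 / 2), φ u * cexp1 (-(r * u)) = s r := by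
  have h := hasSum_integral_mul_of_hasSum hs hφ
    (ψ := fun u => cexp1 (-(r * u))) (continuous_cexp1.comp (by fun_prop))
  have hr' : s r * ∫ u in (-1 / 2 : ℝ)..(1 / 2), cexp1 (r * u) * cexp1 (-(r * u)) = s r := by
    simp only [← cexp1_add, add_neg_cancel, cexp1_zero]
    norm_num
  rw [← hr']
  refine h.unique (hasSum_single r fun n hn => ?_)
  by_cases h0 : s n = 0
  · rw [h0, zero_mul]
  obtain ⟨j, hj⟩ := hsupp n h0
  obtain ⟨i, hi⟩ := hr
  have hji : (n : ℂ) - r = (j - i : ℤ) := by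
    have : n - r = ((j - i : ℤ) : ℚ) := by push_cast; linarith
    exact_mod_cast congrArg (fun x : ℚ => (x : ℂ)) this
  have : j - i ≠ 0 := by
    rintro h
    rw [h] at hji
    apply hn
    simpa [sub_eq_zero] using hji
  rw [← mul_zero (s n), ← integral_cexp1_intCast this]
  congr 2
  funext u
  rw [← cexp1_add, ← hji]
  congr 1
  ring

/-- Integration by parts for Fourier coefficients of `1`-periodic functions. -/
lemma integral_mul_cexp1_of_hasDerivAt {χ χ' : ℝ → ℂ} (hχ : ∀ u, HasDerivAt χ (χ' u) u)
    (hχ' : Continuous χ') (hper : Function.Periodic χ 1) {j : ℤ} (hj : j ≠ 0) :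
    ∫ u in (-1 / 2 : ℝ)..(1 / 2), χ u * cexp1 (-j * u) =
      (2 * Real.pi * Complex.I * j)⁻¹ * ∫ u in (-1 / 2 : ℝ)..(1 / 2), χ' u * cexp1 (-j * u) := by
  have hc : (2 * Real.pi * Complex.I * j : ℂ) ≠ 0 := by
    simp [Real.pi_ne_zero, hj]
  have h := intervalIntegral.integral_mul_deriv_eq_deriv_mul
    (a := -1 / 2) (b := 1 / 2) (fun u _ => hχ u)
    (fun u _ => hasDerivAt_cexp1_mul_ofReal (-j : ℂ) u)
    (hχ'.intervalIntegrable _ _)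
    ((continuous_const.mul (continuous_cexp1.comp (by fun_prop))).intervalIntegrable _ _)
  have hb : χ (1 / 2) = χ (-1 / 2) := by
    rw [← hper (-1 / 2)]
    norm_num
  have he : cexp1 (-j * (1 / 2 : ℝ)) = cexp1 (-j * (-1 / 2 : ℝ)) := by
    have : (-j * (1 / 2 : ℝ) : ℂ) = -j * (-1 / 2 : ℝ) + (-j : ℤ) := by push_cast; ring
    rw [this, cexp1_add, cexp1_intCast, mul_one]
  rw [hb, he, sub_self, zero_sub] at h
  rw [eq_inv_mul_iff_mul_eq₀ hc, ← neg_inj, ← h, ← intervalIntegral.integral_const_mul,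
    ← intervalIntegral.integral_neg]
  congr 1
  funext u
  ring

/-- The Fourier coefficients of a periodic `C²` function decay like `1 / j²`, by integrating by parts
twice. -/
lemma summable_integral_mul_cexp1 {χ : ℝ → ℂ} (hχ : ContDiff ℝ 2 χ)
    (hper : Function.Periodic χ 1) :
    Summable fun j : ℤ => ∫ u in (-1 / 2 : ℝ)..(1 / 2), χ u * cexp1 (-j * u) := by
  have h1 : ∀ u, HasDerivAt χ (deriv χ u) u := fun u =>
    (hχ.differentiable (by norm_num) u).hasDerivAt
  have hχ1 : ContDiff ℝ 1 (deriv χ) := hχ.deriv' (n := 1)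
  have h2 : ∀ u, HasDerivAt (deriv χ) (deriv (deriv χ) u) u := fun u =>
    (hχ1.differentiable (by norm_num) u).hasDerivAt
  have hc2 : Continuous (deriv (deriv χ)) := hχ1.continuous_deriv le_rfl
  have hper1 : Function.Periodic (deriv χ) 1 := fun u => by
    have : (fun u => χ (u + 1)) = χ := funext hper
    rw [← deriv_comp_add_const, this]
  set M := ∫ u in (-1 / 2 : ℝ)..(1 / 2), ‖deriv (deriv χ) u‖
  have hs : Summable fun j : ℤ => M * (1 / (j : ℝ) ^ 2) :=
    (Real.summable_one_div_int_pow.2 one_lt_two).mul_left M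
  refine Summable.of_norm_bounded_eventually hs ?_
  filter_upwards [Set.Finite.compl_mem_cofinite (Set.finite_singleton (0 : ℤ))] with j hj
  have hj : j ≠ 0 := hj
  have hj0 : (0 : ℝ) < (j : ℝ) ^ 2 := by positivity
  rw [integral_mul_cexp1_of_hasDerivAt h1 hχ1.continuous hper hj,
    integral_mul_cexp1_of_hasDerivAt h2 hc2 hper1 hj, ← mul_assoc, norm_mul, mul_comm]
  have hI : ‖∫ u in (-1 / 2 : ℝ)..(1 / 2), deriv (deriv χ) u * cexp1 (-j * u)‖ ≤ M := by
    refine (intervalIntegral.norm_integral_le_integral_norm (by norm_num)).trans_eq ?_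
    refine intervalIntegral.integral_congr fun u _ => ?_
    simp only [norm_mul]
    rw [norm_cexp1_of_im_eq_zero (by simp), mul_one]
  refine mul_le_mul hI ?_ (norm_nonneg _) ((norm_nonneg _).trans hI)
  rw [← mul_inv, norm_inv, one_div]
  refine inv_anti₀ hj0 ?_
  have : (2 * Real.pi * Complex.I * j * (2 * Real.pi * Complex.I * j) : ℂ) =
      ((-((2 * Real.pi) ^ 2 * (j : ℝ) ^ 2) : ℝ) : ℂ) := by
    push_cast
    linear_combination (2 * Real.pi * j : ℂ) ^ 2 * Complex.I_mul_I
  rw [this, Complex.norm_real, norm_neg, Real.norm_of_nonneg (by positivity)]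
  have : 1 ≤ (2 * Real.pi) ^ 2 := one_le_pow₀ (by linarith [Real.pi_gt_three])
  nlinarith

lemma hasSum_cexp1_of_periodic {χ : ℝ → ℂ} (hχ : ContDiff ℝ 2 χ)
    (hper : Function.Periodic χ 1) (u : ℝ) :
    HasSum (fun j : ℤ => (∫ u in (-1 / 2 : ℝ)..(1 / 2), χ u * cexp1 (-j * u)) * cexp1 (j * u))
      (χ u) := by
  have : Fact ((0 : ℝ) < 1) := ⟨one_pos⟩
  have hcont : Continuous (hper.lift : AddCircle (1 : ℝ) → ℂ) :=
    continuous_coinduced_dom.mpr hχ.continuous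
  let f : C(AddCircle (1 : ℝ), ℂ) := ⟨hper.lift, hcont⟩
  have hf : ∀ u : ℝ, f (u : AddCircle (1 : ℝ)) = χ u := fun u => hper.lift_coe u
  have hfour : ∀ (j : ℤ) (u : ℝ), fourier j (u : AddCircle (1 : ℝ)) = cexp1 (j * u) := fun j u => by
    rw [fourier_coe_apply, cexp1]
    congr 1
    push_cast
    ring
  have hco : ∀ j : ℤ, fourierCoeff f j =
      ∫ u in (-1 / 2 : ℝ)..(1 / 2), χ u * cexp1 (-j * u) := fun j => by
    rw [fourierCoeff_eq_intervalIntegral f j (-1 / 2)]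
    simp only [hf, hfour, smul_eq_mul, div_one, one_smul]
    norm_num
    refine intervalIntegral.integral_congr fun u _ => ?_
    simp [mul_comm]
  have := has_pointwise_sum_fourier_series_of_summable (f := f) (by
    simpa only [← hco] using summable_integral_mul_cexp1 hχ hper) (u : AddCircle (1 : ℝ))
  simpa only [hco, hf, hfour, smul_eq_mul] using this

lemma coset_injective (q : ℚ) : Function.Injective fun j : ℤ => q + (j : ℚ) := fun i j h => by
  simpa using h

lemma notMem_range_coset {q n : ℚ} (hn : n ∉ Set.range fun j : ℤ => q + (j : ℚ)) :
    ¬ ∃ j : ℤ, n - q = j := by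
  rintro ⟨j, hj⟩
  exact hn ⟨j, by simp [← hj]⟩

open Classical in
/-- The Fourier series of a `C²` function with `φ(u + 1) = e(q) φ(u)`, indexed by `q + ℤ`. -/
lemma exists_fourier_series {q : ℚ} {φ : ℝ → ℂ} (hφ : ContDiff ℝ 2 φ)
    (hq : ∀ u, φ (u + 1) = cexp1 q * φ u) :
    (Summable fun n : ℚ => if ∃ j : ℤ, n - q = j then
        ∫ u in (-1 / 2 : ℝ)..(1 / 2), φ u * cexp1 (-(n * u)) else 0) ∧
      ∀ u : ℝ, HasSum (fun n : ℚ => (if ∃ j : ℤ, n - q = j then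
        ∫ u in (-1 / 2 : ℝ)..(1 / 2), φ u * cexp1 (-(n * u)) else 0) * cexp1 (n * u)) (φ u) := by
  set χ : ℝ → ℂ := fun u => φ u * cexp1 (-(q * u)) with hχdef
  have hχ : ContDiff ℝ 2 χ := by
    refine hφ.mul ((contDiff_cexp1.restrict_scalars ℝ).comp ?_)
    exact (contDiff_const.mul Complex.ofRealCLM.contDiff).neg
  have hper : Function.Periodic χ 1 := fun u => by
    simp only [hχdef, hq]
    have : (-(q * ((u + 1 : ℝ) : ℂ))) = -(q * u) + -q := by push_cast; ring
    rw [this, cexp1_add]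
    linear_combination φ u * cexp1 (-(q * u)) * cexp1_neg_mul_self q
  have hco : ∀ j : ℤ, (if ∃ i : ℤ, (q + (j : ℚ)) - q = i then
        ∫ u in (-1 / 2 : ℝ)..(1 / 2), φ u * cexp1 (-((q + (j : ℚ) : ℚ) * u)) else 0) =
      ∫ u in (-1 / 2 : ℝ)..(1 / 2), χ u * cexp1 (-j * u) := fun j => by
    rw [if_pos ⟨j, by ring⟩]
    refine intervalIntegral.integral_congr fun u _ => ?_
    simp only [hχdef, mul_assoc, ← cexp1_add]
    congr 2
    push_cast
    ring
  constructor
  · rw [← (coset_injective q).summable_iff fun n hn => if_neg (notMem_range_coset hn)]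
    simpa only [Function.comp_def, hco] using summable_integral_mul_cexp1 hχ hper
  · intro u
    rw [← (coset_injective q).hasSum_iff fun n hn => by
      rw [if_neg (notMem_range_coset hn), zero_mul]]
    have := (hasSum_cexp1_of_periodic hχ hper u).mul_right (cexp1 (q * u))
    simp only [Function.comp_def, hco]
    convert! this using 1
    · funext j
      rw [mul_assoc, ← cexp1_add]
      congr 2
      push_cast
      ring
    · simp only [hχdef, mul_assoc, cexp1_neg_mul_self, mul_one]

/-! ### The Weil representation on the generators -/

namespace EvenLattice

variable {V : Type*} [AddCommGroup V] [Module ℚ V]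

lemma exists_intCast_of_mem_dual (L : EvenLattice V) {x y : V} (hx : x ∈ L.dual)
    (hy : y ∈ L.carrier) : ∃ n : ℤ, L.form x y = n := by
  rw [L.dual_eq] at hx
  obtain ⟨n, hn⟩ := Submodule.mem_one.1 (hx y hy)
  exact ⟨n, by simpa using hn.symm⟩

/-- The bidual of `L` is `L`, as `L` is spanned by a `ℚ`-basis of `V`. -/
lemma mem_carrier_of_forall_dual (L : EvenLattice V) {x : V}
    (hx : ∀ y ∈ L.dual, ∃ n : ℤ, L.form x y = n) : x ∈ L.carrier := by
  have : Module.Finite ℤ L.carrier := Module.Finite.iff_fg.mpr L.fg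
  have : Module.IsTorsionFree ℤ V := Module.IsTorsionFree.trans_faithfulSMul ℤ ℚ V
  let b := Module.Free.chooseBasis ℤ L.carrier
  have hli : LinearIndependent ℤ fun i => (b i : V) :=
    b.linearIndependent.map' L.carrier.subtype (Submodule.ker_subtype _)
  have hspan : Submodule.span ℤ (Set.range fun i => (b i : V)) = L.carrier := by
    have := congrArg (Submodule.map L.carrier.subtype) b.span_eq
    rw [Submodule.map_span, Submodule.map_top, Submodule.range_subtype, ← Set.range_comp] at this
    exact this
  have hspanQ : ⊤ ≤ Submodule.span ℚ (Set.range fun i => (b i : V)) := by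
    rw [← Submodule.span_span_of_tower ℤ ℚ, hspan, L.span_eq_top]
  let B := Module.Basis.mk ((LinearIndependent.iff_fractionRing ℤ ℚ).1 hli) hspanQ
  have hB : Submodule.span ℤ (Set.range B) = L.carrier := by
    have : (B : _ → V) = fun i => (b i : V) := funext fun i => Module.Basis.mk_apply _ _ i
    rw [this, hspan]
  have h := L.form.dualSubmodule_dualSubmodule_of_basis (R := ℤ) L.nondeg L.symm B
  rw [hB, ← L.dual_eq] at h
  rw [← h, LinearMap.BilinForm.mem_dualSubmodule]
  intro y hy
  obtain ⟨n, hn⟩ := hx y hy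
  exact Submodule.mem_one.2 ⟨n, by simp [hn]⟩

lemma cexp1_eq_of_sub_eq_intCast {x y : ℚ} (h : ∃ n : ℤ, x - y = n) : cexp1 x = cexp1 y := by
  obtain ⟨n, hn⟩ := h
  have : (x : ℂ) = y + n := by
    have : x = y + n := by linarith
    exact_mod_cast congrArg (fun z : ℚ => (z : ℂ)) this
  rw [this, cexp1_add, cexp1_intCast, mul_one]

/-- `e((x, y))` only depends on the classes of `x` and `y` in `L^#/L`. -/
lemma cexp1_bilin_mk (L : EvenLattice V) (x y : L.dual) :
    cexp1 (L.bilin (Submodule.Quotient.mk x) (Submodule.Quotient.mk y)) =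
      cexp1 (L.form x y : ℚ) := by
  apply cexp1_eq_of_sub_eq_intCast
  set x' : L.dual := Quotient.out (Submodule.Quotient.mk x : L.Disc) with hx'
  set y' : L.dual := Quotient.out (Submodule.Quotient.mk y : L.Disc) with hy'
  have hx : ((x' - x : L.dual) : V) ∈ L.carrier := by
    have : (Submodule.Quotient.mk x' : L.Disc) = Submodule.Quotient.mk x := Quotient.out_eq _
    exact (Submodule.Quotient.eq (L.carrier.submoduleOf L.dual)).1 this
  have hy : ((y' - y : L.dual) : V) ∈ L.carrier := by
    have : (Submodule.Quotient.mk y' : L.Disc) = Submodule.Quotient.mk y := Quotient.out_eq _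
    exact (Submodule.Quotient.eq (L.carrier.submoduleOf L.dual)).1 this
  obtain ⟨a, ha⟩ := L.exists_intCast_of_mem_dual y'.2 hx
  obtain ⟨c, hc⟩ := L.exists_intCast_of_mem_dual x.2 hy
  refine ⟨a + c, ?_⟩
  rw [bilin, ← hx', ← hy']
  have hsymm : L.form y' x = L.form x y' := L.symm.eq _ _
  have hsymm' : L.form y' x' = L.form x' y' := L.symm.eq _ _
  rw [AddSubgroupClass.coe_sub, map_sub] at ha hc
  push_cast
  linarith

/-- The character `h' ↦ e((h, h'))` of the discriminant group. -/
noncomputable def discChar (L : EvenLattice V) (h : L.Disc) : AddChar L.Disc ℂ where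
  toFun h' := cexp1 (L.bilin h h')
  map_zero_eq_one' := by
    induction h using Submodule.Quotient.induction_on with
    | _ x =>
      rw [← Submodule.Quotient.mk_zero, cexp1_bilin_mk]
      simp [cexp1]
  map_add_eq_mul' a b := by
    induction h using Submodule.Quotient.induction_on with
    | _ x =>
    induction a using Submodule.Quotient.induction_on with
    | _ a =>
    induction b using Submodule.Quotient.induction_on with
    | _ b =>
      rw [← Submodule.Quotient.mk_add, cexp1_bilin_mk, cexp1_bilin_mk, cexp1_bilin_mk, ← cexp1_add]
      congr 1
      push_cast
      simp

lemma discChar_apply (L : EvenLattice V) (h h' : L.Disc) :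
    L.discChar h h' = cexp1 (L.bilin h h') := rfl

lemma bilin_comm (L : EvenLattice V) (h h' : L.Disc) : L.bilin h h' = L.bilin h' h :=
  L.symm.eq _ _

lemma discChar_comm (L : EvenLattice V) (h h' : L.Disc) : L.discChar h h' = L.discChar h' h := by
  rw [discChar_apply, discChar_apply, bilin_comm]

lemma exists_intCast_of_cexp1_eq_one {x : ℚ} (h : cexp1 x = 1) : ∃ n : ℤ, x = n := by
  obtain ⟨n, hn⟩ := Complex.exp_eq_one_iff.1 h
  refine ⟨n, ?_⟩
  have h2 : (2 * Real.pi * Complex.I : ℂ) ≠ 0 := by simp [Real.pi_ne_zero]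
  have : (x : ℂ) = n := mul_left_cancel₀ h2 (by rw [hn]; ring)
  exact_mod_cast this

/-- Non-degeneracy of the pairing on `L^#/L`; here `0` is the trivial character. -/
lemma discChar_ne_zero (L : EvenLattice V) {h : L.Disc} (hh : h ≠ 0) : L.discChar h ≠ 0 := by
  intro h0
  apply hh
  induction h using Submodule.Quotient.induction_on with
  | _ x =>
    refine (Submodule.Quotient.mk_eq_zero _).2 (L.mem_carrier_of_forall_dual fun y hy => ?_)
    have := DFunLike.congr_fun h0 (Submodule.Quotient.mk ⟨y, hy⟩ : L.Disc)
    rw [discChar_apply, cexp1_bilin_mk, AddChar.zero_apply] at this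
    exact exists_intCast_of_cexp1_eq_one this

/-- Orthogonality of characters. -/
lemma sum_discChar_sub (L : EvenLattice V) (a b : L.Disc) :
    ∑ h, L.discChar h a * L.discChar h (-b) = if a = b then (Fintype.card L.Disc : ℂ) else 0 := by
  have : ∀ h, L.discChar h a * L.discChar h (-b) = L.discChar (a - b) h := fun h => by
    rw [← AddChar.map_add_eq_mul, ← sub_eq_add_neg, discChar_comm]
  simp only [this]
  rw [AddChar.sum_eq_ite]
  refine if_congr ⟨fun h0 => ?_, fun h0 => ?_⟩ rfl rfl
  · by_contra hne
    exact L.discChar_ne_zero (sub_ne_zero.2 hne) h0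
  · ext h'
    rw [h0, sub_self, discChar_comm, AddChar.map_zero_eq_one, AddChar.zero_apply]

lemma neg_bilin (L : EvenLattice V) (h h' : L.Disc) : L.neg.bilin h h' = -L.bilin h h' := rfl

lemma neg_quad (L : EvenLattice V) (h : L.Disc) : L.neg.quad h = -L.quad h := by
  rw [quad, neg_bilin, quad, neg_div]

lemma neg_sig (L : EvenLattice V) : L.neg.sig = -L.sig := by
  have : (-L.form).toQuadraticMap = -L.form.toQuadraticMap :=
    LinearMap.BilinMap.toQuadraticMap_neg _
  rw [sig, sig]
  change (sigPos (-L.form).toQuadraticMap : ℤ) - sigNeg (-L.form).toQuadraticMap = _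
  rw [this, sigPos_neg, sigNeg_neg]
  ring

/-- The matrices of `S` for `L⁻` and `L` are contragredient to each other. The type
ascription identifies the discriminant groups of `L⁻` and `L`, which agree by definition. -/
lemma transpose_weilS_neg_mul (L : EvenLattice V) :
    (show Matrix L.Disc L.Disc ℂ from L.neg.weilS).transpose * L.weilS = 1 := by
  have hcard : (Fintype.card L.Disc : ℂ) ≠ 0 := Nat.cast_ne_zero.2 Fintype.card_ne_zero
  have hsq : (Real.sqrt (Fintype.card L.Disc) : ℂ) * Real.sqrt (Fintype.card L.Disc) =
      Fintype.card L.Disc := by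
    rw [← Complex.ofReal_mul, Real.mul_self_sqrt (Nat.cast_nonneg _), Complex.ofReal_natCast]
  have hs0 : (Real.sqrt (Fintype.card L.Disc) : ℂ) ≠ 0 := fun h => hcard (by rw [← hsq, h, zero_mul])
  set ε := Complex.exp (Real.pi * Complex.I / 4) with hε
  have hε0 : ε ≠ 0 := Complex.exp_ne_zero _
  ext a b
  rw [Matrix.mul_apply]
  have hterm : ∀ h : L.Disc, (show Matrix L.Disc L.Disc ℂ from L.neg.weilS).transpose a h *
      L.weilS h b = (Fintype.card L.Disc : ℂ)⁻¹ * (L.discChar h a * L.discChar h (-b)) := by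
    intro h
    have h1 : (show Matrix L.Disc L.Disc ℂ from L.neg.weilS).transpose a h =
        ε ^ L.sig / (Real.sqrt (Fintype.card L.Disc) : ℂ) * L.discChar h a := by
      change ε ^ (-L.neg.sig) / (Real.sqrt (Fintype.card L.Disc) : ℂ) *
        cexp1 (-(L.neg.bilin h a : ℂ)) = _
      rw [neg_sig, neg_neg, neg_bilin, discChar_apply]
      push_cast
      rw [neg_neg]
    have h2 : L.weilS h b =
        ε ^ (-L.sig) / (Real.sqrt (Fintype.card L.Disc) : ℂ) * L.discChar h (-b) := by
      rw [AddChar.map_neg_eq_inv, discChar_apply, weilS, Matrix.of_apply, ← hε]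
      congr 1
      exact eq_inv_of_mul_eq_one_left (cexp1_neg_mul_self _)
    rw [h1, h2, zpow_neg, ← hsq]
    have := zpow_ne_zero L.sig hε0
    field_simp
  rw [Finset.sum_congr rfl fun h _ => hterm h, ← Finset.mul_sum, sum_discChar_sub, Matrix.one_apply]
  split_ifs
  · exact inv_mul_cancel₀ hcard
  · exact mul_zero _

lemma sum_weilS_mulVec_mul (L : EvenLattice V) (x y : L.Disc → ℂ) :
    ∑ h : L.Disc, (L.neg.weilS.mulVec x) h * (L.weilS.mulVec y) h = ∑ h : L.Disc, x h * y h := by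
  have key (A B : Matrix L.Disc L.Disc ℂ) (h : A.transpose * B = 1) :
      A.mulVec x ⬝ᵥ B.mulVec y = x ⬝ᵥ y := by
    rw [Matrix.dotProduct_mulVec, ← Matrix.vecMul_transpose, Matrix.vecMul_vecMul, h,
      Matrix.vecMul_one]
  exact key _ _ L.transpose_weilS_neg_mul

lemma IsAutomorphic.apply_T {L : EvenLattice V} {m : ℤ} {f : ℍ → L.Disc → ℂ}
    (hf : L.IsAutomorphic m f) (τ : ℍ) (h : L.Disc) :
    f ((1 : ℝ) +ᵥ τ) h = cexp1 (L.quad h) * f τ h := by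
  have := congrFun (hf _ _ IsWeil.T τ) h
  rw [show Mp2Z.T.mat = ModularGroup.T from rfl, UpperHalfPlane.modular_T_smul] at this
  rw [this]
  simp [Mp2Z.T, weilT, Matrix.mulVec_diagonal]

/-- The invariant pairing of forms of weights `(4 - m) / 2` and `m / 2` has weight `2`. -/
lemma IsAutomorphic.sum_mul_apply_S {L : EvenLattice V} {m : ℤ} {g f : ℍ → L.Disc → ℂ}
    (hg : L.neg.IsAutomorphic (4 - m) g) (hf : L.IsAutomorphic m f) (τ : ℍ) :
    ∑ h, g (ModularGroup.S • τ) h * f (ModularGroup.S • τ) h = (τ : ℂ) ^ 2 * ∑ h, g τ h * f τ h := by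
  have h1 : g (ModularGroup.S • τ) = ((τ : ℂ) ^ (1 / 2 : ℂ)) ^ (4 - m) • L.neg.weilS.mulVec (g τ) :=
    hg _ _ IsWeil.S τ
  have h2 : f (ModularGroup.S • τ) = ((τ : ℂ) ^ (1 / 2 : ℂ)) ^ m • L.weilS.mulVec (f τ) :=
    hf _ _ IsWeil.S τ
  have hs : ((τ : ℂ) ^ (1 / 2 : ℂ)) ^ 2 = τ := by
    rw [← Complex.cpow_nat_mul]
    norm_num
  have hs0 : (τ : ℂ) ^ (1 / 2 : ℂ) ≠ 0 := fun h => by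
    rw [h] at hs
    exact τ.ne_zero (by rw [← hs]; simp)
  rw [h1, h2, ← L.sum_weilS_mulVec_mul (g τ) (f τ), Finset.mul_sum]
  refine Finset.sum_congr rfl fun h _ => ?_
  change ((τ : ℂ) ^ (1 / 2 : ℂ)) ^ (4 - m) * L.neg.weilS.mulVec (g τ) h *
    (((τ : ℂ) ^ (1 / 2 : ℂ)) ^ m * L.weilS.mulVec (f τ) h) = _
  have : (τ : ℂ) ^ 2 = ((τ : ℂ) ^ (1 / 2 : ℂ)) ^ (4 - m) * ((τ : ℂ) ^ (1 / 2 : ℂ)) ^ m := by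
    rw [← zpow_add₀ hs0, sub_add_cancel]
    conv_lhs => rw [← hs]
    rw [← pow_mul]
    norm_cast
  rw [this]
  ring

end EvenLattice

/-! ### Fourier expansions of holomorphic modular forms -/

section UpperHalfPlane

lemma im_add_mul_I (u v : ℝ) : ((u : ℂ) + v * Complex.I).im = v := by simp

lemma coe_ofComplex_add_mul_I (u : ℝ) {v : ℝ} (hv : 0 < v) :
    ((ofComplex (u + v * Complex.I) : ℍ) : ℂ) = u + v * Complex.I := by
  rw [ofComplex_apply_of_im_pos (by simpa using hv)]

lemma im_ofComplex_add_mul_I (u : ℝ) {v : ℝ} (hv : 0 < v) :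
    (ofComplex (u + v * Complex.I) : ℍ).im = v := by
  rw [← coe_im, coe_ofComplex_add_mul_I u hv, im_add_mul_I]

lemma re_ofComplex_add_mul_I (u : ℝ) {v : ℝ} (hv : 0 < v) :
    (ofComplex (u + v * Complex.I) : ℍ).re = u := by
  rw [← coe_re, coe_ofComplex_add_mul_I u hv]
  simp

lemma ofComplex_re_add_im (τ : ℍ) : ofComplex (τ.re + τ.im * Complex.I) = τ := by
  have : (τ.re + τ.im * Complex.I : ℂ) = τ := Complex.re_add_im _
  rw [this, ofComplex_apply]

lemma ofComplex_add_one {z : ℂ} (hz : 0 < z.im) :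
    ofComplex (z + 1) = (1 : ℝ) +ᵥ ofComplex z := by
  rw [ofComplex_apply_of_im_pos (by simpa using hz), ofComplex_apply_of_im_pos hz]
  ext
  simp [add_comm]

lemma ofComplex_add_one_mul_I (u : ℝ) {v : ℝ} (hv : 0 < v) :
    ofComplex (((u + 1 : ℝ) : ℂ) + v * Complex.I) = (1 : ℝ) +ᵥ ofComplex (u + v * Complex.I) := by
  rw [← ofComplex_add_one (by simpa using hv)]
  congr 1
  push_cast
  ring

end UpperHalfPlane

/-- A bounded holomorphic function with `φ(τ + 1) = e(q) φ(τ)` has a Fourier expansion: twisting by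
`e(-q₀τ)` with `q₀ ∈ q + ℤ`, `q₀ ≤ 0`, makes it `1`-periodic and keeps it bounded. -/
lemma exists_hasSum_of_isBoundedAtImInfty {q : ℚ} {φ : ℍ → ℂ} (hφ : MDifferentiable 𝓘(ℂ) 𝓘(ℂ) φ)
    (hq : ∀ τ : ℍ, φ ((1 : ℝ) +ᵥ τ) = cexp1 q * φ τ) (hb : IsBoundedAtImInfty φ) :
    ∃ b : ℚ → ℂ, (∀ n, b n ≠ 0 → ∃ j : ℤ, n - q = j) ∧
      ∀ τ : ℍ, HasSum (fun n : ℚ => b n * cexp1 (n * (τ : ℂ))) (φ τ) := by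
  set q₀ : ℚ := q - ⌈q⌉ with hq₀
  have hq₀' : q₀ ≤ 0 := sub_nonpos.2 (Int.le_ceil q)
  set ψ : ℍ → ℂ := fun τ => φ τ * cexp1 (-(q₀ * (τ : ℂ))) with hψ
  have hψd : MDifferentiable 𝓘(ℂ) 𝓘(ℂ) ψ := by
    refine hφ.mul (UpperHalfPlane.mdifferentiable_iff.2 fun z hz => ?_)
    have : DifferentiableAt ℂ (fun z : ℂ => cexp1 (-(q₀ * z))) z := by
      simpa only [neg_mul] using (hasDerivAt_cexp1_mul (-q₀) z).differentiableAt
    refine (this.congr_of_eventuallyEq ?_).differentiableWithinAt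
    filter_upwards [eventuallyEq_coe_comp_ofComplex hz] with w hw
    simp only [Function.comp_apply, id] at hw ⊢
    rw [hw]
  have hψper : Function.Periodic (ψ ∘ ofComplex) (1 : ℝ) := fun z => by
    by_cases hz : 0 < z.im
    · simp only [Function.comp_apply, Complex.ofReal_one, ofComplex_add_one hz, hψ, hq, coe_vadd]
      have : (-(q₀ * (1 + (ofComplex z : ℂ)))) = -(q₀ * (ofComplex z : ℂ)) + (-q + (⌈q⌉ : ℤ)) := by
        rw [hq₀]; push_cast; ring
      rw [this, cexp1_add, cexp1_add, cexp1_intCast, mul_one]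
      linear_combination
        φ (ofComplex z) * cexp1 (-(q₀ * (ofComplex z : ℂ))) * cexp1_neg_mul_self q
    · have h1 : (z + (1 : ℝ)).im ≤ 0 := by simpa using not_lt.1 hz
      simp only [Function.comp_apply, ofComplex_apply_eq_of_im_nonpos h1 (not_lt.1 hz)]
  have hψb : IsBoundedAtImInfty ψ := by
    obtain ⟨M, A, hM⟩ := isBoundedAtImInfty_iff.1 hb
    refine isBoundedAtImInfty_iff.2 ⟨M, A, fun τ hτ => ?_⟩
    refine le_trans ?_ (hM τ hτ)
    rw [hψ, norm_mul]
    refine mul_le_of_le_one_right (norm_nonneg _) ?_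
    rw [norm_cexp1, Real.exp_le_one_iff]
    have : (-(q₀ * (τ : ℂ))).im = -(q₀ * τ.im) := by simp
    rw [this, neg_nonpos]
    have h2 : (q₀ : ℝ) ≤ 0 := by exact_mod_cast hq₀'
    have := mul_nonneg (neg_nonneg.2 h2) τ.im_pos.le
    have := mul_nonneg Real.two_pi_pos.le this
    linarith
  have hsum := hasSum_qExpansion one_pos hψper hψd hψb
  set c : ℕ → ℂ := fun m => (qExpansion 1 ψ).coeff m with hc
  have hinj : Function.Injective fun m : ℕ => q₀ + (m : ℚ) := fun i j h => by simpa using h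
  refine ⟨Function.extend (fun m : ℕ => q₀ + (m : ℚ)) c 0, fun n hn => ?_, fun τ => ?_⟩
  · by_contra hne
    apply hn
    rw [Function.extend_apply', Pi.zero_apply]
    rintro ⟨m, rfl⟩
    exact hne ⟨m - ⌈q⌉, by rw [hq₀]; push_cast; ring⟩
  · rw [← hinj.hasSum_iff fun n hn => by rw [Function.extend_apply' _ _ _ hn]; simp]
    have := (hsum τ).mul_right (cexp1 (q₀ * (τ : ℂ)))
    convert! this using 1
    · funext m
      simp only [Function.comp_apply, hinj.extend_apply]
      rw [smul_eq_mul, mul_assoc]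
      congr 1
      have : Function.Periodic.qParam 1 (τ : ℂ) ^ m = cexp1 (m * (τ : ℂ)) := by
        rw [Function.Periodic.qParam, ← Complex.exp_nat_mul, cexp1]
        congr 1
        push_cast
        ring
      rw [this, ← cexp1_add]
      congr 1
      push_cast
      ring
    · simp only [hψ, mul_assoc, cexp1_neg_mul_self, mul_one]

/-- The elements of a coset `q + ℤ` that are positive are bounded away from zero. -/
lemma inv_den_le_of_coset {q n : ℚ} (hn : ∃ j : ℤ, n - q = j) (h0 : 0 < n) :
    (q.den : ℚ)⁻¹ ≤ n := by
  obtain ⟨j, hj⟩ := hn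
  have hd : (0 : ℚ) < q.den := by exact_mod_cast q.den_pos
  have h1 : n * q.den = ((j * q.den + q.num : ℤ) : ℚ) := by
    push_cast
    rw [← Rat.mul_den_eq_num q, ← hj]
    ring
  have h2 : 0 < j * q.den + q.num := by
    have : (0 : ℚ) < ((j * q.den + q.num : ℤ) : ℚ) := by rw [← h1]; positivity
    exact_mod_cast this
  have h3 : (1 : ℚ) ≤ n * q.den := by
    rw [h1]
    exact_mod_cast h2
  rwa [inv_le_iff_one_le_mul₀ hd]

/-- A Fourier expansion whose exponents are at least `δ` decays like `e^{-2πδv}`. -/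
lemma exists_norm_le_of_hasSum {b : ℚ → ℂ} {φ : ℍ → ℂ} {δ : ℚ} (hδ : ∀ n < δ, b n = 0)
    (hφ : ∀ τ : ℍ, HasSum (fun n : ℚ => b n * cexp1 (n * (τ : ℂ))) (φ τ)) {v₀ : ℝ} (hv₀ : 0 < v₀) :
    ∃ C, 0 ≤ C ∧ ∀ τ : ℍ, v₀ ≤ τ.im → ‖φ τ‖ ≤ C * Real.exp (-(2 * Real.pi * δ * τ.im)) := by
  have hnorm (n : ℚ) (τ : ℍ) : ‖b n * cexp1 (n * (τ : ℂ))‖ =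
      ‖b n‖ * Real.exp (-(2 * Real.pi * n * τ.im)) := by
    rw [norm_mul, cexp1_ratCast_mul_tau, norm_mul, norm_cexp1_ratCast_mul_ofReal, mul_one,
      Complex.norm_real, Real.norm_of_nonneg (Real.exp_pos _).le]
  let τ₀ : ℍ := ⟨v₀ * Complex.I, by simpa using hv₀⟩
  have hτ₀ : τ₀.im = v₀ := by simp [τ₀, UpperHalfPlane.im]
  have hs := (hφ τ₀).summable.norm
  simp only [hnorm, hτ₀] at hs
  refine ⟨(∑' n, ‖b n‖ * Real.exp (-(2 * Real.pi * n * v₀))) * Real.exp (2 * Real.pi * δ * v₀),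
    mul_nonneg (tsum_nonneg fun n => by positivity) (Real.exp_pos _).le, fun τ hτ => ?_⟩
  rw [mul_assoc, ← Real.exp_add, ← tsum_mul_right, ← (hφ τ).tsum_eq]
  refine tsum_of_norm_bounded (hs.mul_right _).hasSum fun n => ?_
  rw [hnorm]
  by_cases hn : n < δ
  · simp [hδ n hn]
  · rw [mul_assoc ‖b n‖, ← Real.exp_add]
    refine mul_le_mul_of_nonneg_left (Real.exp_le_exp.2 ?_) (norm_nonneg _)
    have h1 : (0 : ℝ) ≤ n - δ := sub_nonneg.2 (by exact_mod_cast not_lt.1 hn)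
    have := mul_nonneg (mul_nonneg Real.two_pi_pos.le h1) (sub_nonneg.2 hτ)
    linarith

lemma hasSum_horizontal {b : ℚ → ℂ} {φ : ℍ → ℂ}
    (hφ : ∀ τ : ℍ, HasSum (fun n : ℚ => b n * cexp1 (n * (τ : ℂ))) (φ τ)) {v : ℝ} (hv : 0 < v)
    (u : ℝ) : HasSum (fun n : ℚ => b n * Real.exp (-(2 * Real.pi * n * v)) * cexp1 (n * u))
      (φ (ofComplex (u + v * Complex.I))) := by
  have := hφ (ofComplex (u + v * Complex.I))
  simpa only [coe_ofComplex_add_mul_I u hv, cexp1_ratCast_mul, mul_assoc] using this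

lemma summable_horizontal {b : ℚ → ℂ} {φ : ℍ → ℂ}
    (hφ : ∀ τ : ℍ, HasSum (fun n : ℚ => b n * cexp1 (n * (τ : ℂ))) (φ τ)) {v : ℝ} (hv : 0 < v) :
    Summable fun n : ℚ => b n * (Real.exp (-(2 * Real.pi * n * v)) : ℂ) := by
  simpa only [Complex.ofReal_zero, mul_zero, cexp1_zero, mul_one] using
    (hasSum_horizontal hφ hv 0).summable

/-- The `n`-th Fourier coefficient at height `v` of a holomorphic function. -/
lemma integral_horizontal {q : ℚ} {b : ℚ → ℂ} (hb : ∀ n, b n ≠ 0 → ∃ j : ℤ, n - q = j)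
    {φ : ℍ → ℂ} (hφ : ∀ τ : ℍ, HasSum (fun n : ℚ => b n * cexp1 (n * (τ : ℂ))) (φ τ))
    {v : ℝ} (hv : 0 < v) {r : ℚ} (hr : ∃ j : ℤ, r - q = j) :
    ∫ u in (-1 / 2 : ℝ)..(1 / 2), φ (ofComplex (u + v * Complex.I)) * cexp1 (-(r * u)) =
      b r * Real.exp (-(2 * Real.pi * r * v)) :=
  integral_mul_cexp1_of_hasSum (summable_horizontal hφ hv)
    (fun n hn => hb n (left_ne_zero_of_mul hn)) (hasSum_horizontal hφ hv) hr

lemma norm_integral_horizontal_le {M : ℝ} {φ : ℍ → ℂ} {v : ℝ} (hv : 0 < v)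
    (hM : ∀ τ : ℍ, τ.im = v → ‖φ τ‖ ≤ M) (r : ℚ) :
    ‖∫ u in (-1 / 2 : ℝ)..(1 / 2), φ (ofComplex (u + v * Complex.I)) * cexp1 (-(r * u))‖ ≤ M := by
  refine (intervalIntegral.norm_integral_le_of_norm_le_const (C := M) fun u _ => ?_).trans_eq ?_
  · rw [norm_mul, norm_cexp1_of_im_eq_zero (by simp), mul_one]
    exact hM _ (im_ofComplex_add_mul_I u hv)
  · norm_num

/-- The `n`-th coefficient at height `v` is `b n e^{-2πnv}`, which is unbounded in `v` if `n < 0` and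
`b n ≠ 0`. -/
lemma coeff_eq_zero_of_isBoundedAtImInfty {q : ℚ} {b : ℚ → ℂ}
    (hb : ∀ n, b n ≠ 0 → ∃ j : ℤ, n - q = j) {φ : ℍ → ℂ}
    (hφ : ∀ τ : ℍ, HasSum (fun n : ℚ => b n * cexp1 (n * (τ : ℂ))) (φ τ))
    (hbdd : IsBoundedAtImInfty φ) {n : ℚ} (hn : n < 0) : b n = 0 := by
  by_contra h0
  obtain ⟨M, A, hM⟩ := isBoundedAtImInfty_iff.1 hbdd
  have key : ∀ᶠ v in Filter.atTop, ‖b n‖ * Real.exp ((2 * Real.pi * -n) * v) ≤ M := by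
    filter_upwards [Filter.eventually_gt_atTop 0, Filter.eventually_ge_atTop A] with v hv hA
    have := norm_integral_horizontal_le (φ := φ) hv (fun τ hτ => hM τ (by rwa [hτ])) n
    rw [integral_horizontal hb hφ hv (hb n h0), norm_mul, Complex.norm_real,
      Real.norm_of_nonneg (Real.exp_pos _).le] at this
    convert this using 3
    ring
  have hpos : (0 : ℝ) < 2 * Real.pi * -n := by
    have : (n : ℝ) < 0 := by exact_mod_cast hn
    have := Real.pi_pos
    nlinarith
  have htend : Filter.Tendsto (fun v : ℝ => ‖b n‖ * Real.exp ((2 * Real.pi * -n) * v))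
      Filter.atTop Filter.atTop :=
    (Real.tendsto_exp_atTop.comp (Filter.tendsto_id.const_mul_atTop hpos)).const_mul_atTop
      (norm_pos_iff.2 h0)
  obtain ⟨v, h1, h2⟩ := (key.and (htend.eventually_gt_atTop M)).exists
  exact absurd h1 (not_le.2 h2)

lemma coeff_zero_eq_zero_of_isZeroAtImInfty {q : ℚ} {b : ℚ → ℂ}
    (hb : ∀ n, b n ≠ 0 → ∃ j : ℤ, n - q = j) {φ : ℍ → ℂ}
    (hφ : ∀ τ : ℍ, HasSum (fun n : ℚ => b n * cexp1 (n * (τ : ℂ))) (φ τ))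
    (hzero : IsZeroAtImInfty φ) : b 0 = 0 := by
  by_contra h0
  obtain ⟨A, hA⟩ := isZeroAtImInfty_iff.1 hzero (‖b 0‖ / 2) (half_pos (norm_pos_iff.2 h0))
  have hv : 0 < max A 1 := lt_max_of_lt_right one_pos
  have := norm_integral_horizontal_le (φ := φ) hv
    (fun τ hτ => hA τ (by rw [hτ]; exact le_max_left _ _)) 0
  rw [integral_horizontal hb hφ hv (hb 0 h0)] at this
  simp only [Rat.cast_zero, mul_zero, zero_mul, neg_zero, Real.exp_zero, Complex.ofReal_one,
    mul_one] at this
  linarith [norm_pos_iff.2 h0]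

namespace EvenLattice

variable {V : Type*} [AddCommGroup V] [Module ℚ V] {K : EvenLattice V} {m : ℤ}
  {g : ℍ → K.Disc → ℂ}

lemma mdifferentiable_apply (hg : MDifferentiable 𝓘(ℂ) 𝓘(ℂ, K.Disc → ℂ) g) (h : K.Disc) :
    MDifferentiable 𝓘(ℂ) 𝓘(ℂ) fun τ => g τ h :=
  (ContinuousLinearMap.proj (R := ℂ) (φ := fun _ : K.Disc => ℂ) h).mdifferentiable.comp hg

lemma isBoundedAtImInfty_apply (hg : IsBoundedAtImInfty g) (h : K.Disc) :
    IsBoundedAtImInfty fun τ => g τ h := by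
  obtain ⟨M, A, hM⟩ := isBoundedAtImInfty_iff.1 hg
  exact isBoundedAtImInfty_iff.2 ⟨M, A, fun τ hτ => (norm_le_pi_norm _ h).trans (hM τ hτ)⟩

lemma isZeroAtImInfty_apply (hg : IsZeroAtImInfty g) (h : K.Disc) :
    IsZeroAtImInfty fun τ => g τ h :=
  (continuous_apply h).tendsto' 0 0 rfl |>.comp hg

lemma IsCuspForm.isModularForm (hg : K.IsCuspForm m g) : K.IsModularForm m g :=
  ⟨hg.holo, hg.automorphic, hg.zero_at_infty.isBoundedAtImInfty⟩

lemma IsModularForm.exists_isFourierExpansion (hg : K.IsModularForm m g) :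
    ∃ b, K.IsFourierExpansion g b := by
  choose b hb hsum using fun h => exists_hasSum_of_isBoundedAtImInfty
    (mdifferentiable_apply hg.holo h) (fun τ => hg.automorphic.apply_T τ h)
    (isBoundedAtImInfty_apply hg.bounded h)
  exact ⟨b, ⟨hb, fun τ h => hsum h τ⟩⟩

lemma IsFourierExpansion.eq_zero_of_neg {b : K.Disc → ℚ → ℂ} (hb : K.IsFourierExpansion g b)
    (hg : K.IsModularForm m g) (h : K.Disc) {n : ℚ} (hn : n < 0) : b h n = 0 :=
  coeff_eq_zero_of_isBoundedAtImInfty (hb.support h) (fun τ => hb.hasSum τ h)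
    (isBoundedAtImInfty_apply hg.bounded h) hn

lemma IsFourierExpansion.eq_zero_of_nonpos {b : K.Disc → ℚ → ℂ} (hb : K.IsFourierExpansion g b)
    (hg : K.IsCuspForm m g) (h : K.Disc) {n : ℚ} (hn : n ≤ 0) : b h n = 0 := by
  rcases hn.lt_or_eq with hn | rfl
  · exact hb.eq_zero_of_neg hg.isModularForm h hn
  · exact coeff_zero_eq_zero_of_isZeroAtImInfty (hb.support h) (fun τ => hb.hasSum τ h)
      (isZeroAtImInfty_apply hg.zero_at_infty h)

lemma IsModularForm.exists_norm_le (hg : K.IsModularForm m g) (h : K.Disc) :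
    ∃ C, 0 ≤ C ∧ ∀ τ : ℍ, 1 / 2 ≤ τ.im → ‖g τ h‖ ≤ C := by
  obtain ⟨b, hb⟩ := hg.exists_isFourierExpansion
  obtain ⟨C, hC, hle⟩ := exists_norm_le_of_hasSum (δ := 0)
    (fun n hn => hb.eq_zero_of_neg hg h hn) (fun τ => hb.hasSum τ h) one_half_pos
  exact ⟨C, hC, fun τ hτ => by simpa using hle τ hτ⟩

lemma IsCuspForm.exists_norm_le (hg : K.IsCuspForm m g) (h : K.Disc) :
    ∃ C δ : ℝ, 0 ≤ C ∧ 0 < δ ∧ ∀ τ : ℍ, 1 / 2 ≤ τ.im → ‖g τ h‖ ≤ C * Real.exp (-(δ * τ.im)) := by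
  obtain ⟨b, hb⟩ := hg.isModularForm.exists_isFourierExpansion
  have hd : (0 : ℝ) < (K.quad h).den := by exact_mod_cast (K.quad h).den_pos
  obtain ⟨C, hC, hle⟩ := exists_norm_le_of_hasSum (b := b h) (δ := ((K.quad h).den : ℚ)⁻¹)
    (fun n hn => by
      by_contra h0
      rcases le_or_gt n 0 with hn0 | hn0
      · exact h0 (hb.eq_zero_of_nonpos hg h hn0)
      · exact absurd (inv_den_le_of_coset (hb.support h n h0) hn0) (not_le.2 hn))
    (fun τ => hb.hasSum τ h) one_half_pos
  refine ⟨C, 2 * Real.pi * (((K.quad h).den : ℚ)⁻¹ : ℚ), hC, ?_, hle⟩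
  push_cast
  positivity

end EvenLattice

/-! ### Incomplete Gamma integrals -/

/-- The incomplete Gamma function `Γ(1 - k, x)`. -/
noncomputable def gammaTail (k x : ℝ) : ℝ := ∫ t in Set.Ioi x, Real.exp (-t) * t ^ (-k)

lemma continuousOn_exp_neg_mul_rpow (k : ℝ) {x : ℝ} (hx : 0 < x) :
    ContinuousOn (fun t : ℝ => Real.exp (-t) * t ^ (-k)) (Set.Ici x) :=
  (Real.continuous_exp.comp continuous_neg).continuousOn.mul
    (continuousOn_id.rpow_const fun _ ht => Or.inl (hx.trans_le ht).ne')

lemma integrableOn_gammaTail (k : ℝ) {x : ℝ} (hx : 0 < x) :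
    IntegrableOn (fun t : ℝ => Real.exp (-t) * t ^ (-k)) (Set.Ioi x) :=
  integrable_of_isBigO_exp_neg one_half_pos (continuousOn_exp_neg_mul_rpow k hx)
    (Real.Gamma_integrand_isLittleO (-k)).isBigO

lemma gammaTail_nonneg (k : ℝ) {x : ℝ} (hx : 0 < x) : 0 ≤ gammaTail k x :=
  setIntegral_nonneg measurableSet_Ioi fun _ ht =>
    mul_nonneg (Real.exp_pos _).le (Real.rpow_nonneg (hx.trans ht).le _)

lemma gammaTail_anti (k : ℝ) {x y : ℝ} (hx : 0 < x) (hxy : x ≤ y) :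
    gammaTail k y ≤ gammaTail k x :=
  setIntegral_mono_set (integrableOn_gammaTail k hx)
    ((ae_restrict_mem measurableSet_Ioi).mono fun _ ht =>
      mul_nonneg (Real.exp_pos _).le (Real.rpow_nonneg (hx.trans ht).le _))
    (.of_forall (Set.Ioi_subset_Ioi hxy))

lemma tendsto_gammaTail (k : ℝ) : Filter.Tendsto (gammaTail k) Filter.atTop (nhds 0) := by
  have h := intervalIntegral_tendsto_integral_Ioi 1 (integrableOn_gammaTail k one_pos)
    Filter.tendsto_id
  have h2 := (tendsto_const_nhds (x := gammaTail k 1)).sub h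
  rw [show gammaTail k 1 - ∫ t in Set.Ioi 1, Real.exp (-t) * t ^ (-k) = 0 from sub_self _] at h2
  refine h2.congr' ?_
  filter_upwards [Filter.eventually_ge_atTop 1] with x hx
  rw [id, ← intervalIntegral.integral_Ioi_sub_Ioi (integrableOn_gammaTail k one_pos) hx]
  exact sub_sub_cancel _ _

/-- `∫_v^∞ s^{-k} e^{-as} ds`, a rescaled incomplete Gamma function. -/
noncomputable def laplaceTail (k a v : ℝ) : ℝ := ∫ s in Set.Ioi v, s ^ (-k) * Real.exp (-(a * s))

lemma rpow_mul_exp_eq (k : ℝ) {a s : ℝ} (ha : 0 < a) (hs : 0 < s) :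
    s ^ (-k) * Real.exp (-(a * s)) = a ^ k * (Real.exp (-(a * s)) * (a * s) ^ (-k)) := by
  rw [Real.mul_rpow ha.le hs.le, Real.rpow_neg ha.le]
  have := (Real.rpow_pos_of_pos ha k).ne'
  field_simp

lemma integrableOn_laplaceTail (k : ℝ) {a v : ℝ} (ha : 0 < a) (hv : 0 < v) :
    IntegrableOn (fun s => s ^ (-k) * Real.exp (-(a * s))) (Set.Ioi v) := by
  have := (integrableOn_Ioi_comp_mul_left_iff (fun t : ℝ => Real.exp (-t) * t ^ (-k)) v ha).2
    (integrableOn_gammaTail k (mul_pos ha hv))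
  refine IntegrableOn.congr_fun (f := fun s => a ^ k * (Real.exp (-(a * s)) * (a * s) ^ (-k)))
    (this.const_mul (a ^ k)) (fun s hs => ?_) measurableSet_Ioi
  exact (rpow_mul_exp_eq k ha (hv.trans hs)).symm

lemma laplaceTail_eq (k : ℝ) {a v : ℝ} (ha : 0 < a) (hv : 0 < v) :
    laplaceTail k a v = a ^ (k - 1) * gammaTail k (a * v) := by
  have h1 : laplaceTail k a v =
      ∫ s in Set.Ioi v, a ^ k * (Real.exp (-(a * s)) * (a * s) ^ (-k)) :=
    setIntegral_congr_fun measurableSet_Ioi fun s hs => rpow_mul_exp_eq k ha (hv.trans hs)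
  rw [h1, integral_const_mul, gammaTail,
    integral_comp_mul_left_Ioi (fun t => Real.exp (-t) * t ^ (-k)) v ha,
    Real.rpow_sub_one ha.ne', smul_eq_mul]
  ring

lemma laplaceTail_le (k : ℝ) {a b v : ℝ} (hb : 0 < b) (hab : b ≤ a) (hv : 0 < v) :
    laplaceTail k a v ≤ Real.exp (-((a - b) * v)) * laplaceTail k b v := by
  rw [laplaceTail, laplaceTail, ← integral_const_mul]
  refine setIntegral_mono_on (integrableOn_laplaceTail k (hb.trans_le hab) hv)
    ((integrableOn_laplaceTail k hb hv).const_mul _) measurableSet_Ioi fun s hs => ?_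
  have hs' : v ≤ s := le_of_lt hs
  rw [mul_left_comm]
  refine mul_le_mul_of_nonneg_left ?_ (Real.rpow_nonneg (hv.le.trans hs') _)
  rw [← Real.exp_add, Real.exp_le_exp]
  have := mul_nonneg (sub_nonneg.2 hab) (sub_nonneg.2 hs')
  linarith

lemma laplaceTail_nonneg (k a : ℝ) {v : ℝ} (hv : 0 < v) : 0 ≤ laplaceTail k a v :=
  setIntegral_nonneg measurableSet_Ioi fun _ hs =>
    mul_nonneg (Real.rpow_nonneg (hv.trans hs).le _) (Real.exp_pos _).le

/-- The dependence on the height of `minusTerm`. -/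
noncomputable def minusFactor (k : ℝ) (n : ℚ) (v : ℝ) : ℂ :=
  if n = 0 then ((v ^ (1 - k) : ℝ) : ℂ) else maassH k (2 * Real.pi * n * v)

lemma minusTerm_eq (k : ℝ) (n : ℚ) (τ : ℍ) :
    minusTerm k n τ = minusFactor k n τ.im * cexp1 (n * τ.re) := by
  rw [minusTerm, minusFactor]
  split_ifs with h
  · rw [h, Rat.cast_zero, zero_mul, cexp1_zero, mul_one]
  · rfl

/-- For negative index the contour in the definition of `maassH` plays no role. -/
lemma minusFactor_of_neg (k : ℝ) {n : ℚ} (hn : n < 0) {v : ℝ} (hv : 0 < v) :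
    minusFactor k n v =
      Real.exp (-(2 * Real.pi * n * v)) * (gammaTail k (4 * Real.pi * -n * v) : ℂ) := by
  have hn' : (n : ℝ) < 0 := by exact_mod_cast hn
  have hw : 2 * Real.pi * n * v < 0 :=
    mul_neg_of_neg_of_pos (mul_neg_of_pos_of_neg Real.two_pi_pos hn') hv
  rw [minusFactor, if_neg hn.ne, maassH, if_neg (not_lt.2 hw.le), sub_zero, abs_of_neg hw, gammaTail]
  congr 4
  congr 1
  ring

/-! ### Green's formula on rectangles and the Fourier coefficients of `f` -/

lemma isOpen_im_pos : IsOpen {z : ℂ | 0 < z.im} := isOpen_lt continuous_const Complex.continuous_im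

/-- Green's formula on a rectangle of width one, for a function invariant under `z ↦ z + 1`. -/
lemma integral_horizontal_sub {Ψ D : ℂ → ℂ} (hΨ : ContDiffOn ℝ 1 Ψ {z | 0 < z.im})
    (hper : ∀ z : ℂ, 0 < z.im → Ψ (z + 1) = Ψ z)
    (hD : ∀ z : ℂ, 0 < z.im →
      fderiv ℝ Ψ z 1 + Complex.I * fderiv ℝ Ψ z Complex.I = D z)
    {v₁ v₂ : ℝ} (h₁ : 0 < v₁) (h₂ : 0 < v₂) :
    (∫ u in (-1 / 2 : ℝ)..(1 / 2), Ψ (u + v₁ * Complex.I)) -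
        ∫ u in (-1 / 2 : ℝ)..(1 / 2), Ψ (u + v₂ * Complex.I) =
      ∫ u in (-1 / 2 : ℝ)..(1 / 2), ∫ v in v₁..v₂, Complex.I * D (u + v * Complex.I) := by
  set z : ℂ := ⟨-1 / 2, v₁⟩
  set w : ℂ := ⟨1 / 2, v₂⟩
  have hsub : (Set.uIcc z.re w.re ×ℂ Set.uIcc z.im w.im) ⊆ {z : ℂ | 0 < z.im} := fun x hx =>
    (lt_min h₁ h₂).trans_le hx.2.1
  have hcont := hΨ.continuousOn_fderiv_of_isOpen isOpen_im_pos le_rfl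
  have h := Complex.integral_boundary_rect_of_differentiableOn_real Ψ z w
    ((hΨ.differentiableOn one_ne_zero).mono hsub)
    (ContinuousOn.integrableOn_compact (isCompact_uIcc.reProdIm isCompact_uIcc)
      (((hcont.mono hsub).clm_apply continuousOn_const).const_smul Complex.I |>.sub
        ((hcont.mono hsub).clm_apply continuousOn_const)))
  have hside : ∫ y in v₁..v₂, Ψ (w.re + y * Complex.I) =
      ∫ y in v₁..v₂, Ψ (z.re + y * Complex.I) := by
    refine intervalIntegral.integral_congr fun y hy => ?_
    have hy0 : 0 < y := (lt_min h₁ h₂).trans_le hy.1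
    have : (w.re + y * Complex.I : ℂ) = z.re + y * Complex.I + 1 := by
      simp only [z, w]; push_cast; ring
    simp only [this]
    exact hper _ (by simpa using hy0)
  change _ - _ + Complex.I • (∫ y in v₁..v₂, Ψ (w.re + y * Complex.I)) -
    Complex.I • (∫ y in v₁..v₂, Ψ (z.re + y * Complex.I)) = _ at h
  rw [hside, add_sub_cancel_right] at h
  rw [h]
  refine intervalIntegral.integral_congr fun u _ => ?_
  refine intervalIntegral.integral_congr fun v hv => ?_
  have hv0 : 0 < v := (lt_min h₁ h₂).trans_le hv.1
  rw [← hD _ (by simpa using hv0), smul_eq_mul, mul_add, ← mul_assoc, Complex.I_mul_I]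
  ring

/-- The `n`-th Fourier coefficient of `φ` on the horizontal line at height `v`. -/
noncomputable def horizontalCoeff (φ : ℍ → ℂ) (n : ℚ) (v : ℝ) : ℂ :=
  ∫ u in (-1 / 2 : ℝ)..(1 / 2), φ (ofComplex (u + v * Complex.I)) * cexp1 (-(n * u))

/-- The analytic properties of a component `φ` of a form in `H⁺_{k,L}`: it transforms by `e(q)` under
translation, and its antiholomorphic derivative is, up to a constant, `v^{-k}` times the conjugate of a component
`G` of a cusp form, with Fourier coefficients `B`. -/
structure IsHPlusComponent (k : ℝ) (q : ℚ) (φ G : ℍ → ℂ) (B : ℚ → ℂ) : Prop where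
  contDiffOn : ContDiffOn ℝ 2 (φ ∘ ofComplex) {z | 0 < z.im}
  vadd_one : ∀ τ : ℍ, φ ((1 : ℝ) +ᵥ τ) = cexp1 q * φ τ
  dbar : ∀ z : ℂ, 0 < z.im →
    fderiv ℝ (φ ∘ ofComplex) z 1 + Complex.I * fderiv ℝ (φ ∘ ofComplex) z Complex.I =
      Complex.I * ((z.im ^ (-k) : ℝ) : ℂ) * conj (G (ofComplex z))
  continuous : Continuous G
  support : ∀ n, B n ≠ 0 → ∃ j : ℤ, n - -q = j
  hasSum : ∀ τ : ℍ, HasSum (fun n : ℚ => B n * cexp1 (n * (τ : ℂ))) (G τ)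
  eq_zero : ∀ n ≤ 0, B n = 0

lemma continuousOn_ofComplex : ContinuousOn ofComplex {z : ℂ | 0 < z.im} := fun _ hz =>
  (mdifferentiableAt_ofComplex hz).continuousAt.continuousWithinAt

lemma neg_coset {q n : ℚ} (hn : ∃ j : ℤ, n - q = j) : ∃ j : ℤ, -n - -q = j := by
  obtain ⟨j, hj⟩ := hn
  exact ⟨-j, by push_cast; linarith⟩

namespace IsHPlusComponent

variable {k : ℝ} {q : ℚ} {φ G : ℍ → ℂ} {B : ℚ → ℂ}

/-- Green's formula for `φ(z) e(-nz)`, which is invariant under `z ↦ z + 1`. The inner integral over `u`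
of its antiholomorphic derivative is a Fourier coefficient of the conjugate of `G`. -/
lemma exp_mul_horizontalCoeff_sub (hφ : IsHPlusComponent k q φ G B) {n : ℚ}
    (hn : ∃ j : ℤ, n - q = j) {v₁ v₂ : ℝ} (h₁ : 0 < v₁) (h₂ : 0 < v₂) :
    Real.exp (2 * Real.pi * n * v₁) * horizontalCoeff φ n v₁ -
        Real.exp (2 * Real.pi * n * v₂) * horizontalCoeff φ n v₂ =
      -conj (B (-n)) * ((∫ v in v₁..v₂, v ^ (-k) * Real.exp (-(4 * Real.pi * -n * v)) : ℝ) : ℂ) := by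
  set E : ℂ → ℂ := fun z => cexp1 (-n * z) with hE
  have hEsplit : ∀ u v : ℝ, E (u + v * Complex.I) =
      Real.exp (2 * Real.pi * n * v) * cexp1 (-(n * u)) := fun u v => by
    have := cexp1_ratCast_mul (-n) u v
    push_cast at this
    simp only [hE]
    rw [this]
    congr 2
    · push_cast
      congr 1
      ring
    · ring
  have hED : ∀ z, HasFDerivAt E (((2 * Real.pi * Complex.I * -n * E z : ℂ) •
      (1 : ℂ →L[ℂ] ℂ)).restrictScalars ℝ) z := fun z => by
    convert! (hasDerivAt_cexp1_mul (-n) z).hasFDerivAt.restrictScalars ℝ using 1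
    ext x
    simp [hE]
    ring
  have hEc : ContDiff ℝ 1 E :=
    (((contDiff_cexp1.comp (contDiff_const.mul contDiff_id)).restrict_scalars ℝ).of_le
      (by norm_num))
  set Ψ : ℂ → ℂ := fun z => (φ ∘ ofComplex) z * E z with hΨ
  have hgreen := integral_horizontal_sub (Ψ := Ψ)
    (D := fun z => Complex.I * ((z.im ^ (-k) : ℝ) : ℂ) * conj (G (ofComplex z)) * E z)
    ((hφ.contDiffOn.of_le (by norm_num)).mul hEc.contDiffOn)
    (fun z hz => by
      simp only [hΨ, hE, Function.comp_apply, ofComplex_add_one hz, hφ.vadd_one]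
      obtain ⟨j, hj⟩ := hn
      have hnq : (n : ℂ) = q + j := by
        have : n = q + j := by linarith
        exact_mod_cast congrArg (fun x : ℚ => (x : ℂ)) this
      have : -(n : ℂ) * (z + 1) = -n * z + (-q + (-j : ℤ)) := by
        rw [hnq]; push_cast; ring
      rw [this, cexp1_add, cexp1_add, cexp1_intCast, mul_one]
      linear_combination φ (ofComplex z) * cexp1 (-n * z) * cexp1_neg_mul_self q)
    (fun z hz => by
      have hd := ((hφ.contDiffOn.differentiableOn two_ne_zero).differentiableAt
        (isOpen_im_pos.mem_nhds hz)).hasFDerivAt.mul (hED z)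
      rw [show Ψ = φ ∘ ofComplex * E from rfl, hd.fderiv]
      simp only [add_apply, smul_apply,
        ContinuousLinearMap.coe_restrictScalars', one_apply_eq_self, smul_eq_mul]
      rw [← hφ.dbar z hz]
      linear_combination (φ ∘ ofComplex) z * (2 * Real.pi * Complex.I * -n * E z) * Complex.I_mul_I)
    h₁ h₂
  have hleft : ∀ v : ℝ, ∫ u in (-1 / 2 : ℝ)..(1 / 2), Ψ (u + v * Complex.I) =
      Real.exp (2 * Real.pi * n * v) * horizontalCoeff φ n v := fun v => by
    rw [horizontalCoeff, ← intervalIntegral.integral_const_mul]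
    refine intervalIntegral.integral_congr fun u _ => ?_
    simp only [hΨ, hEsplit, Function.comp_apply]
    ring
  rw [hleft, hleft] at hgreen
  rw [hgreen]
  have hpos : ∀ {v : ℝ}, v ∈ Set.uIcc v₁ v₂ → 0 < v := fun hv => (lt_min h₁ h₂).trans_le hv.1
  rw [intervalIntegral_intervalIntegral_swap]
  · rw [← intervalIntegral.integral_ofReal, ← intervalIntegral.integral_const_mul]
    refine intervalIntegral.integral_congr fun v hv => ?_
    have hv0 := hpos hv
    have hG := integral_horizontal hφ.support hφ.hasSum hv0 (neg_coset hn)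
    have hG' := congrArg conj hG
    rw [intervalIntegral.integral_of_le (by norm_num), ← integral_conj,
      ← intervalIntegral.integral_of_le (by norm_num)] at hG'
    have : ∀ u : ℝ, Complex.I * (Complex.I * ((((u + v * Complex.I : ℂ).im) ^ (-k) : ℝ) : ℂ) *
        conj (G (ofComplex (u + v * Complex.I))) * E (u + v * Complex.I)) =
        -(((v ^ (-k) * Real.exp (2 * Real.pi * n * v) : ℝ) : ℂ)) *
          conj (G (ofComplex (u + v * Complex.I)) * cexp1 (-((-n : ℚ) * u))) := fun u => by
      rw [hEsplit, im_add_mul_I, map_mul, conj_cexp1]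
      have : -conj (-(((-n : ℚ) : ℂ) * (u : ℂ))) = -(n * u) := by
        simp
      rw [this]
      push_cast
      linear_combination (((v ^ (-k) : ℝ) : ℂ) * conj (G (ofComplex (u + v * Complex.I))) *
        (Complex.exp (2 * Real.pi * n * v) * cexp1 (-(n * u)))) * Complex.I_mul_I
    simp only [this]
    rw [intervalIntegral.integral_const_mul, hG', map_mul, Complex.conj_ofReal]
    have hexp : Real.exp (-(4 * Real.pi * -n * v)) =
        Real.exp (2 * Real.pi * n * v) * Real.exp (-(2 * Real.pi * (-n : ℚ) * v)) := by
      rw [← Real.exp_add]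
      congr 1
      push_cast
      ring
    rw [hexp]
    push_cast
    ring
  · refine IntegrableOn.mono_set ?_ (Set.prod_mono Set.uIoc_subset_uIcc Set.uIoc_subset_uIcc)
    refine ContinuousOn.integrableOn_compact (isCompact_uIcc.prod isCompact_uIcc) ?_
    have hmap : Continuous fun p : ℝ × ℝ => (p.1 + p.2 * Complex.I : ℂ) := by fun_prop
    have hmaps : Set.MapsTo (fun p : ℝ × ℝ => (p.1 + p.2 * Complex.I : ℂ))
        (Set.uIcc (-1 / 2 : ℝ) (1 / 2) ×ˢ Set.uIcc v₁ v₂) {z : ℂ | 0 < z.im} := fun p hp => by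
      simpa using hpos hp.2
    have hc : ContinuousOn (fun z : ℂ => Complex.I * (Complex.I * ((z.im ^ (-k) : ℝ) : ℂ) *
        conj (G (ofComplex z)) * E z)) {z : ℂ | 0 < z.im} := by
      refine continuousOn_const.mul (((continuousOn_const.mul ?_).mul ?_).mul
        hEc.continuous.continuousOn)
      · exact Complex.continuous_ofReal.comp_continuousOn
          (Complex.continuous_im.continuousOn.rpow_const fun z hz => Or.inl (ne_of_gt hz))
      · exact Complex.continuous_conj.comp_continuousOn
          (hφ.continuous.comp_continuousOn continuousOn_ofComplex)
    exact hc.comp hmap.continuousOn hmaps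

end IsHPlusComponent

/-! ### Fourier expansions of harmonic Maass forms -/

/-- The expansion of one component of a harmonic Maass form. -/
structure IsMaassSeries (k : ℝ) (q : ℚ) (φ : ℍ → ℂ) (ap am : ℚ → ℂ) : Prop where
  support_plus : ∀ n, ap n ≠ 0 → ∃ j : ℤ, n - q = j
  support_minus : ∀ n, am n ≠ 0 → ∃ j : ℤ, n - q = j
  summable_plus : ∀ τ : ℍ, Summable fun n : ℚ => ap n * cexp1 (n * (τ : ℂ))
  summable_minus : ∀ τ : ℍ, Summable fun n : ℚ => am n * minusTerm k n τ
  eq_add : ∀ τ : ℍ, φ τ =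
    (∑' n : ℚ, ap n * cexp1 (n * (τ : ℂ))) + ∑' n : ℚ, am n * minusTerm k n τ

namespace IsMaassSeries

variable {k : ℝ} {q : ℚ} {φ : ℍ → ℂ} {ap am : ℚ → ℂ}

lemma hasSum_horizontal (h : IsMaassSeries k q φ ap am) {v : ℝ} (hv : 0 < v) (u : ℝ) :
    HasSum (fun n : ℚ => (ap n * Real.exp (-(2 * Real.pi * n * v)) + am n * minusFactor k n v) *
      cexp1 (n * u)) (φ (ofComplex (u + v * Complex.I))) := by
  have := (h.summable_plus (ofComplex (u + v * Complex.I))).hasSum.add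
    (h.summable_minus (ofComplex (u + v * Complex.I))).hasSum
  rw [← h.eq_add] at this
  simpa only [coe_ofComplex_add_mul_I u hv, cexp1_ratCast_mul, minusTerm_eq,
    im_ofComplex_add_mul_I u hv, re_ofComplex_add_mul_I u hv, add_mul, mul_assoc] using this

lemma summable_minus_horizontal (h : IsMaassSeries k q φ ap am) {v : ℝ} (hv : 0 < v) :
    Summable fun n : ℚ => am n * minusFactor k n v := by
  have := h.summable_minus (ofComplex ((0 : ℝ) + v * Complex.I))
  simp only [minusTerm_eq, im_ofComplex_add_mul_I 0 hv, re_ofComplex_add_mul_I 0 hv] at this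
  simpa only [Complex.ofReal_zero, mul_zero, cexp1_zero, mul_one] using this

lemma horizontalCoeff_eq (h : IsMaassSeries k q φ ap am) {v : ℝ} (hv : 0 < v) {n : ℚ}
    (hn : ∃ j : ℤ, n - q = j) :
    horizontalCoeff φ n v =
      ap n * Real.exp (-(2 * Real.pi * n * v)) + am n * minusFactor k n v := by
  refine integral_mul_cexp1_of_hasSum ?_ (fun n hn => ?_) (h.hasSum_horizontal hv) hn
  · simpa only [Complex.ofReal_zero, mul_zero, cexp1_zero, mul_one] using
      (h.hasSum_horizontal hv 0).summable
  · by_contra hne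
    apply hn
    rw [not_imp_comm.1 (h.support_plus n) hne, not_imp_comm.1 (h.support_minus n) hne]
    simp

lemma exp_mul_horizontalCoeff_of_neg (h : IsMaassSeries k q φ ap am) {v : ℝ} (hv : 0 < v) {n : ℚ}
    (hn : ∃ j : ℤ, n - q = j) (hn0 : n < 0) :
    Real.exp (2 * Real.pi * n * v) * horizontalCoeff φ n v =
      ap n + am n * gammaTail k (4 * Real.pi * -n * v) := by
  have hexp : (Real.exp (2 * Real.pi * n * v) : ℂ) * Real.exp (-(2 * Real.pi * n * v)) = 1 := by
    rw [← Complex.ofReal_mul, ← Real.exp_add, add_neg_cancel, Real.exp_zero, Complex.ofReal_one]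
  rw [h.horizontalCoeff_eq hv hn, minusFactor_of_neg k hn0 hv]
  linear_combination (ap n + am n * gammaTail k (4 * Real.pi * -n * v)) * hexp

/-- For `k ≠ 1` there is no term `v^{1-k}`, as the `0`-th coefficient is independent of `v`. -/
lemma minus_zero_eq_zero (h : IsMaassSeries k q φ ap am) {G : ℍ → ℂ} {B : ℚ → ℂ}
    (hφ : IsHPlusComponent k q φ G B) (hk : k ≠ 1) : am 0 = 0 := by
  by_contra h0
  have hn := h.support_minus 0 h0
  have hconst := hφ.exp_mul_horizontalCoeff_sub hn one_pos two_pos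
  rw [h.horizontalCoeff_eq one_pos hn, h.horizontalCoeff_eq two_pos hn, neg_zero,
    hφ.eq_zero 0 le_rfl] at hconst
  simp only [minusFactor, if_pos, Rat.cast_zero, mul_zero, zero_mul, neg_zero, Real.exp_zero,
    Complex.ofReal_one, one_mul, mul_one, Real.one_rpow, map_zero] at hconst
  have h1 : am 0 * (1 - ((2 ^ (1 - k) : ℝ) : ℂ)) = 0 := by linear_combination hconst
  rcases mul_eq_zero.1 h1 with h1 | h1
  · exact h0 h1
  · have h2 : (2 : ℝ) ^ (1 - k) = 1 := by
      have := sub_eq_zero.1 h1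
      exact_mod_cast this.symm
    rw [← Real.rpow_zero (2 : ℝ), Real.rpow_right_inj two_pos (by norm_num)] at h2
    exact hk (by linarith)

/-- Exponential growth bounds the principal part: by `exp_mul_horizontalCoeff_of_neg` and the decay of
the incomplete Gamma function, `a⁺(n)` is the limit of `e^{2πnv} c_n(v)` as `v → ∞`. -/
lemma plus_eq_zero_of_growth (h : IsMaassSeries k q φ ap am) {C : ℝ}
    (hC : φ =O[atImInfty] fun τ => Real.exp (C * τ.im)) {n : ℚ} (hn0 : n < 0)
    (hn : C < 2 * Real.pi * -n) : ap n = 0 := by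
  by_contra h0
  have hn' := h.support_plus n h0
  obtain ⟨M, hM⟩ := hC.bound
  rw [Filter.Eventually, atImInfty_mem] at hM
  obtain ⟨A, hA⟩ := hM
  have hnR : (n : ℝ) < 0 := by exact_mod_cast hn0
  have hlim1 : Filter.Tendsto (fun v : ℝ =>
      ap n + am n * (gammaTail k (4 * Real.pi * -n * v) : ℂ)) Filter.atTop (nhds (ap n)) := by
    have hp : 0 < 4 * Real.pi * -n := mul_pos (by positivity) (by linarith)
    have := (Complex.continuous_ofReal.tendsto _).comp
      ((tendsto_gammaTail k).comp (Filter.tendsto_id.const_mul_atTop hp))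
    simpa using (this.const_mul (am n)).const_add (ap n)
  have hlim2 : Filter.Tendsto (fun v : ℝ => M * Real.exp (-((2 * Real.pi * -n - C) * v)))
      Filter.atTop (nhds 0) := by
    have := Real.tendsto_exp_neg_atTop_nhds_zero.comp
      (Filter.tendsto_id.const_mul_atTop (sub_pos.2 hn))
    simpa using this.const_mul M
  have hlim3 : Filter.Tendsto (fun v : ℝ =>
      ap n + am n * (gammaTail k (4 * Real.pi * -n * v) : ℂ)) Filter.atTop (nhds 0) := by
    refine squeeze_zero_norm' ?_ hlim2
    filter_upwards [Filter.eventually_gt_atTop 0, Filter.eventually_ge_atTop A] with v hv hvA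
    rw [← h.exp_mul_horizontalCoeff_of_neg hv hn' hn0, norm_mul, Complex.norm_real,
      Real.norm_of_nonneg (Real.exp_pos _).le]
    have hle := norm_integral_horizontal_le (φ := φ) (M := M * Real.exp (C * v)) hv
      (fun τ hτ => by
        have : ‖φ τ‖ ≤ M * ‖Real.exp (C * τ.im)‖ := hA τ (by rwa [hτ])
        rwa [hτ, Real.norm_of_nonneg (Real.exp_pos _).le] at this) n
    calc Real.exp (2 * Real.pi * n * v) * ‖horizontalCoeff φ n v‖
        ≤ Real.exp (2 * Real.pi * n * v) * (M * Real.exp (C * v)) :=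
          mul_le_mul_of_nonneg_left hle (Real.exp_pos _).le
      _ = M * Real.exp (-((2 * Real.pi * -n - C) * v)) := by
          rw [mul_left_comm, ← Real.exp_add]
          congr 2
          ring
  exact h0 (tendsto_nhds_unique hlim1 hlim3)

lemma finite_principalPart (h : IsMaassSeries k q φ ap am) {C : ℝ}
    (hC : φ =O[atImInfty] fun τ => Real.exp (C * τ.im)) : {n : ℚ | n ≤ 0 ∧ ap n ≠ 0}.Finite := by
  obtain ⟨N, hN⟩ := exists_nat_gt (C / (2 * Real.pi))
  refine ((Set.finite_Icc (-(N : ℤ) - ⌈q⌉) (-⌊q⌋)).image fun j : ℤ => q + (j : ℚ)).subset ?_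
  rintro n ⟨hn0, hn⟩
  obtain ⟨j, hj⟩ := h.support_plus n hn
  refine ⟨j, ⟨?_, ?_⟩, by simp only; linarith⟩
  · by_contra hlt
    have h1 : (j : ℚ) < -(N : ℚ) - ⌈q⌉ := by exact_mod_cast not_le.1 hlt
    have h2 := Int.le_ceil q
    have h3 : n < -(N : ℚ) := by linarith
    have h4 : (n : ℝ) < -(N : ℝ) := by exact_mod_cast h3
    refine hn (h.plus_eq_zero_of_growth hC (h3.trans_le (by simp)) ?_)
    rw [div_lt_iff₀ Real.two_pi_pos] at hN
    have := mul_lt_mul_of_pos_left h4 Real.two_pi_pos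
    linarith
  · rw [← Int.cast_le (R := ℚ)]
    have := Int.floor_le q
    push_cast
    by_contra hlt
    have h1 : -⌊q⌋ < j := by
      have := not_le.1 hlt
      exact_mod_cast this
    have h2 : (1 : ℚ) ≤ j + ⌊q⌋ := by exact_mod_cast (by omega : 1 ≤ j + ⌊q⌋)
    linarith

end IsMaassSeries

open Classical in
/-- Existence of the expansion: the Fourier coefficients of `φ` satisfy
`e^{2πnv} c_n(v) = a⁺(n) + a⁻(n) Γ(1 - k, 4π|n|v)` for `n < 0` and are constant multiples of
`e^{-2πnv}` for `n ≥ 0`. -/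
lemma IsHPlusComponent.exists_isMaassSeries {k : ℝ} {q : ℚ} {φ G : ℍ → ℂ} {B : ℚ → ℂ}
    (hφ : IsHPlusComponent k q φ G B) : ∃ ap am, IsMaassSeries k q φ ap am := by
  set J : ℚ → ℝ → ℝ := fun n v => laplaceTail k (4 * Real.pi * -n) v with hJ
  -- `4π|n|` to the power `k - 1` rescales the Laplace integral `J` to an incomplete Gamma function.
  set am : ℚ → ℂ := fun n => -conj (B (-n)) * ((4 * Real.pi * -n) ^ (k - 1) : ℝ) with ham
  -- Green's formula between the heights `1` and `v` expresses `c_n(v)` through `c_n(1)`.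
  set ap : ℚ → ℂ := fun n => if ∃ j : ℤ, n - q = j then
    Real.exp (2 * Real.pi * n * 1) * horizontalCoeff φ n 1 + conj (B (-n)) * J n 1 else 0 with hap
  have hpos : ∀ {n : ℚ}, n < 0 → 0 < 4 * Real.pi * -(n : ℝ) := fun {n} hn => by
    have : (n : ℝ) < 0 := by exact_mod_cast hn
    exact mul_pos (by positivity) (neg_pos.2 this)
  have hB0 : ∀ {n : ℚ}, 0 ≤ n → B (-n) = 0 := fun hn => hφ.eq_zero _ (neg_nonpos.2 hn)
  have hminus : ∀ n {v : ℝ}, 0 < v → am n * minusFactor k n v =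
      -conj (B (-n)) * (Real.exp (-(2 * Real.pi * n * v)) * J n v : ℝ) := fun n v hv => by
    rcases lt_or_ge n 0 with hn | hn
    · simp only [hJ, ham]
      rw [minusFactor_of_neg k hn hv, laplaceTail_eq k (hpos hn) hv]
      push_cast
      ring
    · simp [ham, hB0 hn]
  have hsuppm : ∀ n, am n ≠ 0 → ∃ j : ℤ, n - q = j := fun n hn => by
    have : B (-n) ≠ 0 := fun h0 => hn (by simp [ham, h0])
    obtain ⟨j, hj⟩ := hφ.support _ this
    exact ⟨-j, by push_cast; linarith⟩
  have hcoeff : ∀ n {v : ℝ}, 0 < v → (if ∃ j : ℤ, n - q = j then horizontalCoeff φ n v else 0) =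
      ap n * Real.exp (-(2 * Real.pi * n * v)) + am n * minusFactor k n v := fun n v hv => by
    by_cases hn : ∃ j : ℤ, n - q = j
    · rw [if_pos hn, hminus n hv, hap]
      simp only [if_pos hn]
      have hexp : (Real.exp (2 * Real.pi * n * v) : ℂ) * Real.exp (-(2 * Real.pi * n * v)) = 1 := by
        rw [← Complex.ofReal_mul, ← Real.exp_add, add_neg_cancel, Real.exp_zero,
          Complex.ofReal_one]
      have hsub := hφ.exp_mul_horizontalCoeff_sub hn one_pos hv
      have hJsub : conj (B (-n)) * ((∫ s in (1 : ℝ)..v, s ^ (-k) *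
          Real.exp (-(4 * Real.pi * -n * s)) : ℝ) : ℂ) =
          conj (B (-n)) * ((J n 1 : ℂ) - J n v) := by
        rcases lt_or_ge n 0 with hn0 | hn0
        · rw [← intervalIntegral.integral_Ioi_sub_Ioi' (integrableOn_laplaceTail k (hpos hn0) one_pos)
            (integrableOn_laplaceTail k (hpos hn0) hv), Complex.ofReal_sub]
          rfl
        · simp [hB0 hn0]
      push_cast at hexp hsub hJsub ⊢
      linear_combination (-horizontalCoeff φ n v) * hexp -
        Complex.exp (-(2 * Real.pi * n * v)) * hsub +
        Complex.exp (-(2 * Real.pi * n * v)) * hJsub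
    · rw [if_neg hn, not_imp_comm.1 (hsuppm n) hn]
      simp [hap, hn]
  have hseries : ∀ {v : ℝ}, 0 < v → _ := fun {v} hv =>
    exists_fourier_series (q := q) (φ := fun u : ℝ => φ (ofComplex (u + v * Complex.I)))
      (by
        refine contDiffOn_univ.1 (hφ.contDiffOn.comp (s := Set.univ)
          (f := fun u : ℝ => (u + v * Complex.I : ℂ)) ?_ fun u _ => ?_)
        · exact (Complex.ofRealCLM.contDiff.add contDiff_const).contDiffOn
        · simpa using hv)
      (fun u => by rw [ofComplex_add_one_mul_I u hv, hφ.vadd_one])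
  -- The exponents with `B (-n) ≠ 0` satisfy `4π|n| ≥ a₀`, so the factor `J n v` is at most
  -- `e^{-4π|n|v}` up to a constant, and the series is dominated by that of `G` at the same height.
  have hJle : ∀ {v : ℝ}, 0 < v → ∃ C, ∀ n : ℚ, ‖am n * minusFactor k n v‖ ≤
      C * ‖B (-n) * (Real.exp (-(2 * Real.pi * (-n : ℚ) * v)) : ℂ)‖ := fun {v} hv => by
    set a₀ : ℝ := 4 * Real.pi * (((-q).den : ℚ)⁻¹ : ℚ) with ha₀
    have ha₀pos : 0 < a₀ := by
      have : (0 : ℚ) < ((-q).den : ℚ)⁻¹ := inv_pos.2 (by exact_mod_cast (-q).den_pos)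
      have : (0 : ℝ) < (((-q).den : ℚ)⁻¹ : ℚ) := by exact_mod_cast this
      positivity
    refine ⟨Real.exp (a₀ * v) * laplaceTail k a₀ v, fun n => ?_⟩
    rw [hminus n hv]
    by_cases h0 : B (-n) = 0
    · simp [h0]
    have hn : 0 < -n := by
      by_contra hn
      exact h0 (hφ.eq_zero _ (not_lt.1 hn))
    have hle : a₀ ≤ 4 * Real.pi * -n := by
      have h1 := inv_den_le_of_coset (hφ.support _ h0) hn
      have h2 : (((-q).den : ℚ)⁻¹ : ℚ) ≤ ((-n : ℚ) : ℝ) := Rat.cast_le.2 h1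
      rw [ha₀]
      push_cast at h2 ⊢
      exact mul_le_mul_of_nonneg_left h2 (by positivity)
    rw [norm_mul, norm_mul, norm_neg, RCLike.norm_conj, Complex.norm_real, Complex.norm_real,
      Real.norm_of_nonneg (Real.exp_pos _).le,
      Real.norm_of_nonneg (mul_nonneg (Real.exp_pos _).le (laplaceTail_nonneg _ _ hv)),
      mul_left_comm (Real.exp (a₀ * v) * _)]
    refine mul_le_mul_of_nonneg_left ?_ (norm_nonneg _)
    refine (mul_le_mul_of_nonneg_left (laplaceTail_le k ha₀pos hle hv)
      (Real.exp_pos _).le).trans_eq ?_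
    rw [← mul_assoc, ← Real.exp_add, mul_right_comm (Real.exp (a₀ * v)), ← Real.exp_add]
    congr 2
    push_cast
    ring
  have hsm : ∀ τ : ℍ, Summable fun n : ℚ => am n * minusTerm k n τ := fun τ => by
    obtain ⟨C, hC⟩ := hJle τ.im_pos
    have hs := (summable_horizontal hφ.hasSum τ.im_pos).norm
    have hs' := ((Equiv.neg ℚ).summable_iff.2 hs).mul_left C
    refine Summable.of_norm_bounded hs' fun n => ?_
    rw [minusTerm_eq, ← mul_assoc, norm_mul, norm_cexp1_ratCast_mul_ofReal, mul_one]
    exact hC n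
  have hsum : ∀ τ : ℍ, HasSum (fun n : ℚ =>
      ap n * cexp1 (n * (τ : ℂ)) + am n * minusTerm k n τ) (φ τ) := fun τ => by
    have := (hseries τ.im_pos).2 τ.re
    rw [ofComplex_re_add_im] at this
    refine this.congr_fun fun n => ?_
    have := hcoeff n τ.im_pos
    rw [horizontalCoeff] at this
    rw [this, minusTerm_eq, cexp1_ratCast_mul_tau]
    ring
  have hsp : ∀ τ : ℍ, Summable fun n : ℚ => ap n * cexp1 (n * (τ : ℂ)) := fun τ => by
    simpa using (hsum τ).summable.sub (hsm τ)
  refine ⟨ap, am, fun n hn => ?_, hsuppm, hsp, hsm, fun τ => ?_⟩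
  · by_contra hne
    exact hn (if_neg hne)
  · rw [← (hsp τ).tsum_add (hsm τ), (hsum τ).tsum_eq]

/-! ### The constant term of the product of expansions -/

/-- As the height `T` tends to infinity, the integral of `γφ` over a horizontal segment tends to the
constant term formed with the principal part: the contribution of `a⁻` is a series of incomplete
Gamma functions and tends to zero by dominated convergence. -/
lemma tendsto_integral_mul {k : ℝ} {q : ℚ} {φ γ G : ℍ → ℂ} {ap am b B : ℚ → ℂ}
    (hφ : IsHPlusComponent k q φ G B) (h : IsMaassSeries k q φ ap am) (hk : k ≠ 1)
    (hfin : {n : ℚ | n ≤ 0 ∧ ap n ≠ 0}.Finite)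
    (hb : ∀ n, b n ≠ 0 → ∃ j : ℤ, n - -q = j)
    (hγ : ∀ τ : ℍ, HasSum (fun n : ℚ => b n * cexp1 (n * (τ : ℂ))) (γ τ))
    (hneg : ∀ n < 0, b n = 0) :
    Filter.Tendsto (fun T : ℝ => ∫ u in (-1 / 2 : ℝ)..(1 / 2),
      γ (ofComplex (u + T * Complex.I)) * φ (ofComplex (u + T * Complex.I)))
      Filter.atTop (nhds (∑ᶠ n ∈ Set.Iic (0 : ℚ), ap n * b (-n))) := by
  set E : ℚ → ℝ → ℝ := fun n T => if 0 < n then gammaTail k (4 * Real.pi * n * T) else 0 with hE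
  have hbn : ∀ n, b n ≠ 0 → ∃ j : ℤ, -n - q = j := fun n hn => by
    obtain ⟨j, hj⟩ := hb n hn
    exact ⟨-j, by push_cast; linarith⟩
  have hexp : ∀ x : ℝ, (Real.exp (-x) : ℂ) * Real.exp x = 1 := fun x => by
    rw [← Complex.ofReal_mul, ← Real.exp_add, neg_add_cancel, Real.exp_zero, Complex.ofReal_one]
  have hE' : ∀ n {T : ℝ}, 0 < T →
      b n * (am (-n) * (E n T : ℂ)) = b n * (Real.exp (-(2 * Real.pi * n * T)) : ℂ) *
        (am (-n) * minusFactor k (-n) T) := fun n T hT => by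
    rcases lt_trichotomy n 0 with hn | rfl | hn
    · simp [hneg n hn]
    · simp [h.minus_zero_eq_zero hφ hk]
    · simp only [hE, if_pos hn]
      rw [minusFactor_of_neg k (neg_lt_zero.2 hn) hT]
      have := hexp (2 * Real.pi * n * T)
      push_cast at this ⊢
      simp only [neg_neg, mul_neg, neg_mul]
      linear_combination (-(b n * am (-n) * gammaTail k (4 * Real.pi * n * T))) * this
  -- Integrating termwise against `φ` pairs `b n` with the `(-n)`-th Fourier coefficient of `φ`.
  have hterm : ∀ n {T : ℝ}, 0 < T →
      b n * (Real.exp (-(2 * Real.pi * n * T)) : ℂ) *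
        ∫ u in (-1 / 2 : ℝ)..(1 / 2), cexp1 (n * u) * φ (ofComplex (u + T * Complex.I)) =
      b n * ap (-n) + b n * (am (-n) * (E n T : ℂ)) := fun n T hT => by
    by_cases h0 : b n = 0
    · simp [h0]
    have hI : ∫ u in (-1 / 2 : ℝ)..(1 / 2), cexp1 (n * u) * φ (ofComplex (u + T * Complex.I)) =
        horizontalCoeff φ (-n) T := by
      rw [horizontalCoeff]
      refine intervalIntegral.integral_congr fun u _ => ?_
      simp [mul_comm]
    rw [hI, h.horizontalCoeff_eq hT (hbn n h0), hE' n hT]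
    have := hexp (2 * Real.pi * n * T)
    push_cast at this ⊢
    simp only [neg_neg, mul_neg, neg_mul]
    linear_combination (b n * ap (-n)) * this
  have hint : ∀ {T : ℝ}, 0 < T → ∫ u in (-1 / 2 : ℝ)..(1 / 2),
      γ (ofComplex (u + T * Complex.I)) * φ (ofComplex (u + T * Complex.I)) =
      ∑' n, (b n * ap (-n) + b n * (am (-n) * (E n T : ℂ))) := fun {T} hT => by
    have hc : Continuous fun u : ℝ => φ (ofComplex (u + T * Complex.I)) := by
      have hu : Continuous fun u : ℝ => (u + T * Complex.I : ℂ) := by fun_prop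
      exact hφ.contDiffOn.continuousOn.comp_continuous hu fun u => by simpa using hT
    have := hasSum_integral_mul_of_hasSum (summable_horizontal hγ hT) (hasSum_horizontal hγ hT) hc
    simp only [hterm _ hT] at this
    exact this.tsum_eq.symm
  have hfin' : (Function.support fun n => b n * ap (-n)).Finite := by
    refine (hfin.image fun n => -n).subset fun n hn => ?_
    have hn' : b n * ap (-n) ≠ 0 := hn
    have hle : -n ≤ 0 := by
      by_contra hlt
      exact left_ne_zero_of_mul hn' (hneg n (by linarith [not_le.1 hlt]))
    exact ⟨-n, ⟨hle, right_ne_zero_of_mul hn'⟩, neg_neg n⟩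
  have hlim : ∑' n, b n * ap (-n) = ∑ᶠ n ∈ Set.Iic (0 : ℚ), ap n * b (-n) := by
    rw [tsum_eq_finsum hfin', ← finsum_comp_equiv (Equiv.neg ℚ)]
    refine finsum_congr fun n => ?_
    simp only [Equiv.neg_apply, neg_neg]
    by_cases hn : n ≤ 0
    · rw [finsum_eq_if, if_pos (Set.mem_Iic.2 hn), mul_comm]
    · rw [finsum_eq_if, if_neg (by simpa using hn), hneg (-n) (by linarith [not_le.1 hn]), zero_mul]
  rw [← hlim]
  have hbsum := summable_horizontal hγ one_pos
  have hmsum : Summable fun n => am (-n) * minusFactor k (-n) 1 :=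
    (h.summable_minus_horizontal one_pos).comp_injective neg_injective
  have hdom₁ : Summable fun n => b n * ap (-n) := summable_of_hasFiniteSupport hfin'
  -- The terms at height `1` dominate those at height `T ≥ 1`, as `gammaTail` is antitone.
  have hdom₂ : Summable fun n => b n * (am (-n) * (E n 1 : ℂ)) := by
    simp only [hE' _ one_pos]
    refine Summable.of_norm_bounded
      (hmsum.norm.mul_left (∑' n, ‖b n * (Real.exp (-(2 * Real.pi * n * 1)) : ℂ)‖)) fun n => ?_
    rw [norm_mul]
    exact mul_le_mul_of_nonneg_right
      (hbsum.norm.le_tsum n fun _ _ => norm_nonneg _) (norm_nonneg _)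
  have hdom := hdom₁.norm.add hdom₂.norm
  have htend := tendsto_tsum_of_dominated_convergence (𝓕 := Filter.atTop)
    (f := fun T n => b n * ap (-n) + b n * (am (-n) * (E n T : ℂ)))
    (g := fun n => b n * ap (-n)) hdom (fun n => by
      have : Filter.Tendsto (fun T => (E n T : ℂ)) Filter.atTop (nhds 0) := by
        by_cases hn : 0 < n
        · have hnR : (0 : ℝ) < n := by exact_mod_cast hn
          simp only [hE, if_pos hn]
          have := (Complex.continuous_ofReal.tendsto _).comp ((tendsto_gammaTail k).comp
            (Filter.tendsto_id.const_mul_atTop (by positivity : 0 < 4 * Real.pi * (n : ℝ))))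
          simpa [Function.comp_def] using this
        · simp [hE, hn]
      simpa using ((this.const_mul (am (-n))).const_mul (b n)).const_add (b n * ap (-n)))
    (by
      filter_upwards [Filter.eventually_ge_atTop 1] with T hT n
      suffices hEle : ‖E n T‖ ≤ ‖E n 1‖ by
        have hle : ‖b n * (am (-n) * (E n T : ℂ))‖ ≤ ‖b n * (am (-n) * (E n 1 : ℂ))‖ := by
          simp only [norm_mul, Complex.norm_real]
          gcongr
        exact (norm_add_le _ _).trans (add_le_add le_rfl hle)
      by_cases hn : 0 < n
      · have hnR : (0 : ℝ) < n := by exact_mod_cast hn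
        have hp : 0 < 4 * Real.pi * (n : ℝ) := by positivity
        simp only [hE, if_pos hn]
        rw [Real.norm_of_nonneg (gammaTail_nonneg k (by positivity)),
          Real.norm_of_nonneg (gammaTail_nonneg k (by positivity))]
        exact gammaTail_anti k (by positivity) (mul_le_mul_of_nonneg_left hT hp.le)
      · simp [hE, hn])
  refine htend.congr' ?_
  filter_upwards [Filter.eventually_gt_atTop 0] with T hT
  exact (hint hT).symm

/-! ### Stokes' theorem on the truncated fundamental domain -/

/-- The height of the unit circle over `u`. -/
noncomputable def arcHeight (u : ℝ) : ℝ := Real.sqrt (1 - u ^ 2)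

lemma one_sub_sq_pos {u : ℝ} (hu : u ∈ Set.Icc (-1 / 2 : ℝ) (1 / 2)) : 0 < 1 - u ^ 2 := by
  nlinarith [hu.1, hu.2]

lemma arcHeight_pos {u : ℝ} (hu : u ∈ Set.Icc (-1 / 2 : ℝ) (1 / 2)) : 0 < arcHeight u :=
  Real.sqrt_pos.2 (one_sub_sq_pos hu)

lemma arcHeight_le_one (u : ℝ) : arcHeight u ≤ 1 :=
  Real.sqrt_le_one.2 (by nlinarith [sq_nonneg u])

lemma arcHeight_neg (u : ℝ) : arcHeight (-u) = arcHeight u := by simp [arcHeight]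

lemma continuous_arcHeight : Continuous arcHeight := by unfold arcHeight; fun_prop

lemma sq_arcHeight {u : ℝ} (hu : u ∈ Set.Icc (-1 / 2 : ℝ) (1 / 2)) :
    arcHeight u ^ 2 = 1 - u ^ 2 :=
  Real.sq_sqrt (one_sub_sq_pos hu).le

lemma hasDerivAt_arcHeight {u : ℝ} (hu : u ∈ Set.Icc (-1 / 2 : ℝ) (1 / 2)) :
    HasDerivAt arcHeight (-u / arcHeight u) u := by
  have h : HasDerivAt (fun u : ℝ => 1 - u ^ 2) (-(2 * u)) u := by
    simpa using (hasDerivAt_pow 2 u).const_sub 1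
  convert! h.sqrt (one_sub_sq_pos hu).ne' using 1
  rw [arcHeight, neg_div, neg_div, mul_div_mul_left _ _ two_ne_zero]

/-- The integral of an invariant differential over the arc of the fundamental domain vanishes: the
map `z ↦ -1/z`, which is `u ↦ -u` on the arc, reverses its orientation. -/
lemma integral_arc_eq_zero {F : ℂ → ℂ} (hS : ∀ z : ℂ, 0 < z.im → F (-z⁻¹) = z ^ 2 * F z) :
    ∫ u in (-1 / 2 : ℝ)..(1 / 2), F (u + arcHeight u * Complex.I) *
      (1 + Complex.I * ((-u / arcHeight u : ℝ) : ℂ)) = 0 := by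
  set A : ℝ → ℂ := fun u => F (u + arcHeight u * Complex.I) *
    (1 + Complex.I * ((-u / arcHeight u : ℝ) : ℂ)) with hA
  -- `F dz` is invariant, so its pullback to the arc is an odd function of `u`.
  have hodd : ∀ u ∈ Set.Icc (-1 / 2 : ℝ) (1 / 2), A (-u) = -A u := fun u hu => by
    have hy := arcHeight_pos hu
    have hyC : (arcHeight u : ℂ) ≠ 0 := by exact_mod_cast hy.ne'
    have hsq : (arcHeight u : ℂ) ^ 2 = 1 - (u : ℂ) ^ 2 := by exact_mod_cast sq_arcHeight hu
    set z : ℂ := u + arcHeight u * Complex.I with hz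
    have hprod : z * (u - arcHeight u * Complex.I) = 1 := by
      rw [hz]
      linear_combination (-(arcHeight u : ℂ) ^ 2) * Complex.I_mul_I + hsq
    have hz0 : z ≠ 0 := left_ne_zero_of_mul_eq_one hprod
    have hinv : ((-u : ℝ) : ℂ) + arcHeight u * Complex.I = -z⁻¹ := by
      rw [inv_eq_of_mul_eq_one_right hprod]
      push_cast
      ring
    simp only [hA, arcHeight_neg]
    rw [hinv, hS z (by simpa [hz] using hy), ← hz]
    have h1 : (arcHeight u : ℂ) + Complex.I * u = Complex.I * (u - arcHeight u * Complex.I) := by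
      linear_combination (arcHeight u : ℂ) * Complex.I_mul_I
    have h2 : Complex.I * z = -(arcHeight u - Complex.I * u) := by
      rw [hz]
      linear_combination (arcHeight u : ℂ) * Complex.I_mul_I
    have h3 : z ^ 2 * (arcHeight u + Complex.I * u) = -(arcHeight u - Complex.I * u) := by
      rw [h1, ← h2]
      linear_combination (Complex.I * z) * hprod
    have h4 : 1 + Complex.I * (u / arcHeight u : ℂ) = (arcHeight u + Complex.I * u) / arcHeight u := by
      field_simp
    have h5 : 1 + Complex.I * (-u / arcHeight u : ℂ) =
        (arcHeight u - Complex.I * u) / arcHeight u := by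
      field_simp
      ring
    push_cast
    rw [neg_neg]
    linear_combination (F z / arcHeight u) * h3 + z ^ 2 * F z * h4 + F z * h5
  have h1 : ∫ u in (-1 / 2 : ℝ)..(1 / 2), A u = ∫ u in (-1 / 2 : ℝ)..(1 / 2), A (-u) := by
    rw [intervalIntegral.integral_comp_neg A]
    norm_num
  have h2 : ∫ u in (-1 / 2 : ℝ)..(1 / 2), A (-u) = -∫ u in (-1 / 2 : ℝ)..(1 / 2), A u := by
    rw [← intervalIntegral.integral_neg]
    refine intervalIntegral.integral_congr fun u hu => hodd u ?_
    rwa [Set.uIcc_of_le (by norm_num)] at hu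
  rw [h2] at h1
  exact self_eq_neg.1 h1

/-- Stokes' theorem for the invariant differential `F dz` on `{|u| ≤ 1/2, |z| ≥ 1, v ≤ T}`. The region is
parametrized by `(u, t) ↦ u + i(y + t(T - y))` with `y = √(1 - u²)`, `0 ≤ t ≤ 1`. The vertical sides
cancel by translation invariance. -/
lemma integral_truncated_fundamentalDomain {F D : ℂ → ℂ} (hF : ContDiffOn ℝ 1 F {z | 0 < z.im})
    (hT : ∀ z : ℂ, 0 < z.im → F (z + 1) = F z)
    (hS : ∀ z : ℂ, 0 < z.im → F (-z⁻¹) = z ^ 2 * F z)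
    (hD : ∀ z : ℂ, 0 < z.im →
      fderiv ℝ F z 1 + Complex.I * fderiv ℝ F z Complex.I = D z) {T : ℝ} (h1T : 1 ≤ T) :
    ∫ u in (-1 / 2 : ℝ)..(1 / 2), ∫ v in (arcHeight u)..T, Complex.I * D (u + v * Complex.I) =
      -∫ u in (-1 / 2 : ℝ)..(1 / 2), F (u + T * Complex.I) := by
  set Φ : ℝ → ℝ → ℂ := fun u t =>
    u + ((arcHeight u + (T - arcHeight u) * t : ℝ) : ℂ) * Complex.I with hΦ
  set y' : ℝ → ℝ := fun u => -u / arcHeight u with hy'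
  set Q : ℝ × ℝ → ℂ := fun p => F (Φ p.1 p.2) * (Complex.I * ((T - arcHeight p.1 : ℝ) : ℂ)) with hQ
  set P : ℝ × ℝ → ℂ := fun p =>
    -(F (Φ p.1 p.2) * (1 + Complex.I * (((1 - p.2) * y' p.1 : ℝ) : ℂ))) with hP
  have hmem : ∀ {u t : ℝ}, u ∈ Set.Icc (-1 / 2 : ℝ) (1 / 2) → t ∈ Set.Icc (0 : ℝ) 1 →
      0 < (Φ u t).im := fun {u t} hu ht => by
    have him : (Φ u t).im = arcHeight u + (T - arcHeight u) * t := im_add_mul_I _ _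
    rw [him]
    have := mul_nonneg (sub_nonneg.2 ((arcHeight_le_one u).trans h1T)) ht.1
    linarith [arcHeight_pos hu]
  have hFd : ∀ {z : ℂ}, 0 < z.im → HasFDerivAt F (fderiv ℝ F z) z := fun {z} hz =>
    ((hF.differentiableOn one_ne_zero).differentiableAt (isOpen_im_pos.mem_nhds hz)).hasFDerivAt
  have hyd : ∀ p : ℝ × ℝ, p.1 ∈ Set.Icc (-1 / 2 : ℝ) (1 / 2) →
      DifferentiableAt ℝ (fun p : ℝ × ℝ => arcHeight p.1) p := fun p hp =>
    (hasDerivAt_arcHeight hp).differentiableAt.comp p differentiableAt_fst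
  have hy'd : ∀ p : ℝ × ℝ, p.1 ∈ Set.Icc (-1 / 2 : ℝ) (1 / 2) →
      DifferentiableAt ℝ (fun p : ℝ × ℝ => y' p.1) p := fun p hp => by
    simp only [hy', div_eq_mul_inv]
    exact differentiableAt_fst.neg.mul ((hyd p hp).inv (arcHeight_pos hp).ne')
  have hΦd : ∀ p : ℝ × ℝ, p.1 ∈ Set.Icc (-1 / 2 : ℝ) (1 / 2) →
      DifferentiableAt ℝ (fun p : ℝ × ℝ => Φ p.1 p.2) p := fun p hp => by
    have h1 : DifferentiableAt ℝ (fun p : ℝ × ℝ => (p.1 : ℂ)) p :=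
      Complex.ofRealCLM.differentiableAt.comp p differentiableAt_fst
    have h2 : DifferentiableAt ℝ
        (fun p : ℝ × ℝ => ((arcHeight p.1 + (T - arcHeight p.1) * p.2 : ℝ) : ℂ)) p :=
      Complex.ofRealCLM.differentiableAt.comp p
        ((hyd p hp).add (((hyd p hp).const_sub T).mul differentiableAt_snd))
    exact h1.add (h2.mul_const _)
  have hFΦd : ∀ p ∈ Set.Icc (-1 / 2 : ℝ) (1 / 2) ×ˢ Set.Icc (0 : ℝ) 1,
      DifferentiableAt ℝ (fun p : ℝ × ℝ => F (Φ p.1 p.2)) p := fun p hp =>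
    (hFd (hmem hp.1 hp.2)).differentiableAt.comp p (hΦd p hp.1)
  have hQd : ∀ p ∈ Set.Icc (-1 / 2 : ℝ) (1 / 2) ×ˢ Set.Icc (0 : ℝ) 1, DifferentiableAt ℝ Q p :=
    fun p hp => (hFΦd p hp).mul ((Complex.ofRealCLM.differentiableAt.comp p
      ((hyd p hp.1).const_sub T)).const_mul _)
  have hPd : ∀ p ∈ Set.Icc (-1 / 2 : ℝ) (1 / 2) ×ˢ Set.Icc (0 : ℝ) 1, DifferentiableAt ℝ P p :=
    fun p hp => ((hFΦd p hp).mul (((Complex.ofRealCLM.differentiableAt.comp p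
      ((differentiableAt_snd.const_sub 1).mul (hy'd p hp.1))).const_mul _).const_add 1)).neg
  -- The pullback of `F dz` is `-P du + Q dt`, and this is its exterior derivative.
  have hdiv : ∀ p ∈ Set.Icc (-1 / 2 : ℝ) (1 / 2) ×ˢ Set.Icc (0 : ℝ) 1,
      fderiv ℝ Q p (1, 0) + fderiv ℝ P p (0, 1) =
        Complex.I * ((T - arcHeight p.1 : ℝ) : ℂ) * D (Φ p.1 p.2) := by
    rintro ⟨u, t⟩ ⟨hu, ht⟩
    have hu : u ∈ Set.Icc (-1 / 2 : ℝ) (1 / 2) := hu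
    have ht : t ∈ Set.Icc (0 : ℝ) 1 := ht
    have hy := hasDerivAt_arcHeight hu
    have hFz := hFd (hmem hu ht)
    set c : ℝ := T - arcHeight u with hc
    have hlin : ∀ a b : ℝ, fderiv ℝ F (Φ u t) (a + b * Complex.I) =
        a * fderiv ℝ F (Φ u t) 1 + b * fderiv ℝ F (Φ u t) Complex.I := fun a b => by
      have : (a + b * Complex.I : ℂ) = a • (1 : ℂ) + b • Complex.I := by simp
      rw [this, map_add, map_smul, map_smul, Complex.real_smul, Complex.real_smul]
    have hΦu : HasDerivAt (fun u : ℝ => Φ u t) (((1 : ℝ) : ℂ) + (((1 - t) * y' u : ℝ) : ℂ) *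
        Complex.I) u := by
      refine (hasDerivAt_id u).ofReal_comp.add (HasDerivAt.mul_const (HasDerivAt.ofReal_comp ?_) _)
      convert! hy.add ((hy.const_sub T).mul_const t) using 1
      simp only [hy']
      ring
    have hΦt : HasDerivAt (fun t : ℝ => Φ u t) (((0 : ℝ) : ℂ) + (c : ℂ) * Complex.I) t := by
      refine HasDerivAt.add ?_ (HasDerivAt.mul_const (HasDerivAt.ofReal_comp ?_) _)
      · simpa using hasDerivAt_const t (u : ℂ)
      · simpa using ((hasDerivAt_id t).const_mul c).const_add (arcHeight u)
    have hQu : HasDerivAt (fun u : ℝ => Q (u, t))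
        (fderiv ℝ F (Φ u t) (((1 : ℝ) : ℂ) + (((1 - t) * y' u : ℝ) : ℂ) * Complex.I) *
          (Complex.I * (c : ℂ)) + F (Φ u t) * (Complex.I * ((-y' u : ℝ) : ℂ))) u := by
      exact (hFz.comp_hasDerivAt u hΦu).mul ((hy.const_sub T).ofReal_comp.const_mul _)
    have hPt : HasDerivAt (fun t : ℝ => P (u, t))
        (-(fderiv ℝ F (Φ u t) (((0 : ℝ) : ℂ) + (c : ℂ) * Complex.I) *
          (1 + Complex.I * (((1 - t) * y' u : ℝ) : ℂ)) +
            F (Φ u t) * (Complex.I * ((-y' u : ℝ) : ℂ)))) t := by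
      refine ((hFz.comp_hasDerivAt t hΦt).mul
        ((HasDerivAt.const_mul _ (HasDerivAt.ofReal_comp ?_)).const_add 1)).neg
      simpa using ((hasDerivAt_id t).const_sub 1).mul_const (y' u)
    have hQ' := (hQd (u, t) ⟨hu, ht⟩).hasFDerivAt.comp_hasDerivAt u
      ((hasDerivAt_id u).prodMk (hasDerivAt_const u t))
    have hP' := (hPd (u, t) ⟨hu, ht⟩).hasFDerivAt.comp_hasDerivAt t
      ((hasDerivAt_const t u).prodMk (hasDerivAt_id t))
    rw [hQ'.unique hQu, hP'.unique hPt, hlin, hlin, ← hD _ (hmem hu ht)]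
    push_cast
    linear_combination (-(fderiv ℝ F (Φ u t) Complex.I * c)) * Complex.I_mul_I
  have hDc : ContinuousOn D {z | 0 < z.im} := by
    have hcont := hF.continuousOn_fderiv_of_isOpen isOpen_im_pos le_rfl
    exact ((hcont.clm_apply continuousOn_const).add
      (continuousOn_const.mul (hcont.clm_apply continuousOn_const))).congr
        fun z hz => (hD z hz).symm
  have huIcc : Set.uIcc (-1 / 2 : ℝ) (1 / 2) = Set.Icc (-1 / 2 : ℝ) (1 / 2) :=
    Set.uIcc_of_le (by norm_num)
  have htIcc : Set.uIcc (0 : ℝ) 1 = Set.Icc 0 1 := Set.uIcc_of_le zero_le_one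
  have hIoo : Set.Ioo (min (-1 / 2 : ℝ) (1 / 2)) (max (-1 / 2 : ℝ) (1 / 2)) ×ˢ
      Set.Ioo (min (0 : ℝ) 1) (max (0 : ℝ) 1) ⊆
        Set.Icc (-1 / 2 : ℝ) (1 / 2) ×ˢ Set.Icc (0 : ℝ) 1 := by
    rw [min_eq_left (by norm_num), max_eq_right (by norm_num), min_eq_left zero_le_one,
      max_eq_right zero_le_one]
    exact Set.prod_mono Set.Ioo_subset_Icc_self Set.Ioo_subset_Icc_self
  have hdivint : IntegrableOn (fun p => fderiv ℝ Q p (1, 0) + fderiv ℝ P p (0, 1))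
      (Set.uIcc (-1 / 2 : ℝ) (1 / 2) ×ˢ Set.uIcc (0 : ℝ) 1) := by
    refine ContinuousOn.integrableOn_compact (isCompact_uIcc.prod isCompact_uIcc) ?_
    rw [huIcc, htIcc]
    refine ContinuousOn.congr ?_ hdiv
    refine ContinuousOn.mul ?_ (hDc.comp (fun p hp => (hΦd p hp.1).continuousAt.continuousWithinAt)
      fun p hp => hmem hp.1 hp.2)
    have := continuous_arcHeight
    fun_prop
  have hstokes := integral2_divergence_prod_of_hasFDerivAt Q P (fderiv ℝ Q) (fderiv ℝ P)
    (-1 / 2) 0 (1 / 2) 1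
    (by rw [huIcc, htIcc]; exact fun p hp => (hQd p hp).continuousAt.continuousWithinAt)
    (by rw [huIcc, htIcc]; exact fun p hp => (hPd p hp).continuousAt.continuousWithinAt)
    (fun p hp => (hQd p (hIoo hp)).hasFDerivAt) (fun p hp => (hPd p (hIoo hp)).hasFDerivAt) hdivint
  have hleft : ∫ u in (-1 / 2 : ℝ)..(1 / 2), ∫ v in (arcHeight u)..T,
      Complex.I * D (u + v * Complex.I) =
      ∫ u in (-1 / 2 : ℝ)..(1 / 2), ∫ t in (0 : ℝ)..1,
        fderiv ℝ Q (u, t) (1, 0) + fderiv ℝ P (u, t) (0, 1) := by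
    refine intervalIntegral.integral_congr fun u hu => ?_
    rw [huIcc] at hu
    have hsub := intervalIntegral.smul_integral_comp_add_mul (a := 0) (b := 1)
      (fun v : ℝ => Complex.I * D (u + v * Complex.I)) (T - arcHeight u) (arcHeight u)
    rw [mul_zero, mul_one, add_zero, add_sub_cancel] at hsub
    rw [← hsub, ← intervalIntegral.integral_smul]
    refine intervalIntegral.integral_congr fun t ht => ?_
    rw [htIcc] at ht
    rw [hdiv (u, t) ⟨hu, ht⟩, Complex.real_smul]
    ring
  have hside : ∫ t in (0 : ℝ)..1, Q (1 / 2, t) = ∫ t in (0 : ℝ)..1, Q (-1 / 2, t) := by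
    refine intervalIntegral.integral_congr fun t ht => ?_
    rw [htIcc] at ht
    have hneg : arcHeight (1 / 2) = arcHeight (-1 / 2) := by
      rw [← arcHeight_neg]
      norm_num
    have hz : Φ (1 / 2) t = Φ (-1 / 2) t + 1 := by
      simp only [hΦ, hneg]
      push_cast
      ring
    simp only [hQ, hz, hneg]
    rw [hT _ (hmem ⟨le_rfl, by norm_num⟩ ht)]
  have htop : ∫ u in (-1 / 2 : ℝ)..(1 / 2), P (u, 1) =
      -∫ u in (-1 / 2 : ℝ)..(1 / 2), F (u + T * Complex.I) := by
    rw [← intervalIntegral.integral_neg]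
    refine intervalIntegral.integral_congr fun u _ => ?_
    simp [hP, hΦ]
  have hbot : ∫ u in (-1 / 2 : ℝ)..(1 / 2), P (u, 0) = 0 := by
    rw [← neg_eq_zero, ← intervalIntegral.integral_neg, ← integral_arc_eq_zero hS]
    refine intervalIntegral.integral_congr fun u _ => ?_
    simp [hP, hΦ, hy']
  rw [hleft, hstokes, hside, htop, hbot]
  ring

/-! ### Integration over the fundamental domain -/

/-- The standard fundamental domain in the coordinates `(u, v)`. -/
def fdCoord : Set (ℝ × ℝ) := {p | 0 < p.2 ∧ 1 ≤ p.1 ^ 2 + p.2 ^ 2 ∧ |p.1| ≤ 1 / 2}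

lemma measurableSet_fdCoord : MeasurableSet fdCoord := by
  refine MeasurableSet.inter (measurableSet_lt measurable_const measurable_snd)
    (MeasurableSet.inter (measurableSet_le measurable_const
      ((measurable_fst.pow_const 2).add (measurable_snd.pow_const 2))) ?_)
  exact (isClosed_le (f := fun p : ℝ × ℝ => |p.1|) (by fun_prop) continuous_const).measurableSet

lemma fdCoord_subset : fdCoord ⊆ Set.Icc (-1 / 2 : ℝ) (1 / 2) ×ˢ Set.Ioi (1 / 2 : ℝ) := by
  rintro ⟨u, v⟩ ⟨hv, h1, hu⟩
  simp only at hv h1 hu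
  rw [abs_le] at hu
  refine ⟨⟨by simpa using! hu.1.trans_eq' (by norm_num), hu.2⟩, ?_⟩
  simp only [Set.mem_Ioi]
  by_contra hlt
  nlinarith [not_lt.1 hlt, hu.1, hu.2]

lemma mem_fdCoord_iff {u v : ℝ} :
    (u, v) ∈ fdCoord ↔ u ∈ Set.Icc (-1 / 2 : ℝ) (1 / 2) ∧ arcHeight u ≤ v := by
  constructor
  · intro h
    refine ⟨(fdCoord_subset h).1, Real.sqrt_le_iff.2 ⟨h.1.le, ?_⟩⟩
    have := h.2.1
    simp only at this
    linarith
  · rintro ⟨hu, hv⟩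
    refine ⟨(arcHeight_pos hu).trans_le hv, ?_, abs_le.2 ⟨?_, hu.2⟩⟩
    · have := (Real.sqrt_le_iff.1 hv).2
      simp only
      linarith
    · have := hu.1
      norm_num at this ⊢
      exact this

/-- The invariant measure on the fundamental domain in the coordinates `(u, v)`. -/
lemma integrableOn_fd_and_setIntegral_fd (P : ℍ → ℂ) :
    (IntegrableOn P 𝒟 ↔ IntegrableOn (fun p : ℝ × ℝ =>
      ((p.2 ^ 2)⁻¹ : ℝ) • P (ofComplex (p.1 + p.2 * Complex.I))) fdCoord) ∧
    ∫ τ in 𝒟, P τ = ∫ p in fdCoord, ((p.2 ^ 2)⁻¹ : ℝ) • P (ofComplex (p.1 + p.2 * Complex.I)) := by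
  set ν : Measure ℍ := volume.comap UpperHalfPlane.coe with hν
  set d : ℍ → NNReal := fun z => (1 / NNReal.mk z.im z.im_pos.le) ^ 2 with hd
  have hdm : Measurable d := by
    refine Continuous.measurable (.pow (.div₀ continuous_const ?_ ?_) _)
    · exact UpperHalfPlane.continuous_im.subtype_mk _
    · exact fun x => NNReal.ne_iff.mp x.im_ne_zero
  set S : Set ℂ := {z | 0 < z.im ∧ 1 ≤ z.re ^ 2 + z.im ^ 2 ∧ |z.re| ≤ 1 / 2} with hS
  set H : ℂ → ℂ := fun z => ((z.im ^ 2)⁻¹ : ℝ) • P (ofComplex z) with hH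
  have hSp : Complex.measurableEquivRealProd.symm ⁻¹' S = fdCoord := rfl
  have hSm : MeasurableSet S := by
    have := Complex.measurableEquivRealProd.measurable measurableSet_fdCoord
    exact this
  have hDS : 𝒟 = UpperHalfPlane.coe ⁻¹' S := by
    ext τ
    simp only [ModularGroup.fd, hS, Set.mem_ofPred_eq, Set.mem_preimage, Complex.normSq_apply]
    constructor
    · rintro ⟨h1, h2⟩
      exact ⟨τ.im_pos, by simpa [sq] using h1, h2⟩
    · rintro ⟨-, h1, h2⟩
      exact ⟨by simpa [sq] using h1, h2⟩
  have hDm : MeasurableSet 𝒟 := hDS ▸ measurable_coe hSm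
  have hdens : ((volume : Measure ℍ).restrict 𝒟) =
      (ν.restrict 𝒟).withDensity fun z => (d z : ENNReal) := by
    rw [volume_def, restrict_withDensity hDm]
  have hdH : (fun z : ℍ => d z • P z) = H ∘ UpperHalfPlane.coe := by
    funext z
    simp only [hd, hH, Function.comp_apply, ofComplex_apply, NNReal.smul_def]
    congr 1
    simp
  have hmap : ν.map UpperHalfPlane.coe = (volume : Measure ℂ).restrict (Set.range UpperHalfPlane.coe) :=
    measurableEmbedding_coe.map_comap _
  have hrange : S ⊆ Set.range UpperHalfPlane.coe := fun z hz => ⟨⟨z, hz.1⟩, rfl⟩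
  have hrestr : (ν.map UpperHalfPlane.coe).restrict S = (volume : Measure ℂ).restrict S := by
    rw [hmap, Measure.restrict_restrict hSm, Set.inter_eq_left.2 hrange]
  have hmp := Complex.volume_preserving_equiv_real_prod.symm
  have hcomp : ∀ p : ℝ × ℝ, H (Complex.measurableEquivRealProd.symm p) =
      ((p.2 ^ 2)⁻¹ : ℝ) • P (ofComplex (p.1 + p.2 * Complex.I)) := fun p => by
    have : Complex.measurableEquivRealProd.symm p = (p.1 + p.2 * Complex.I : ℂ) :=
      Complex.mk_eq_add_mul_I _ _
    rw [this]
    simp only [hH, im_add_mul_I]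
  constructor
  · rw [IntegrableOn, hdens, integrable_withDensity_iff_integrable_smul hdm, hdH, hDS]
    change IntegrableOn (H ∘ UpperHalfPlane.coe) (UpperHalfPlane.coe ⁻¹' S) ν ↔ _
    rw [← measurableEmbedding_coe.integrableOn_map_iff, IntegrableOn, hrestr, ← IntegrableOn,
      ← hmp.integrableOn_comp_preimage Complex.measurableEquivRealProd.symm.measurableEmbedding, hSp]
    simp only [Function.comp_def, hcomp]
  · rw [hdens, integral_withDensity_eq_integral_smul hdm, hdH, hDS]
    change ∫ z in UpperHalfPlane.coe ⁻¹' S, H (z : ℂ) ∂ν = _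
    rw [← measurableEmbedding_coe.setIntegral_map, hrestr,
      ← hmp.setIntegral_preimage_emb Complex.measurableEquivRealProd.symm.measurableEmbedding, hSp]
    simp only [hcomp]

/-- Integrals over the truncated fundamental domain, by Fubini. -/
lemma setIntegral_fdCoord_inter {W : ℝ × ℝ → ℂ} {T : ℝ} (hT : 1 ≤ T)
    (hW : IntegrableOn W (fdCoord ∩ {p | p.2 ≤ T})) :
    ∫ p in fdCoord ∩ {p | p.2 ≤ T}, W p =
      ∫ u in (-1 / 2 : ℝ)..(1 / 2), ∫ v in (arcHeight u)..T, W (u, v) := by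
  have hm : MeasurableSet (fdCoord ∩ {p : ℝ × ℝ | p.2 ≤ T}) :=
    measurableSet_fdCoord.inter (measurableSet_le measurable_snd measurable_const)
  rw [← integral_indicator hm, Measure.volume_eq_prod, integral_prod _ (by
    rw [← Measure.volume_eq_prod]; exact (integrable_indicator_iff hm).2 hW),
    intervalIntegral.integral_of_le (by norm_num), ← integral_Icc_eq_integral_Ioc,
    ← integral_indicator measurableSet_Icc]
  congr 1
  funext u
  by_cases hu : u ∈ Set.Icc (-1 / 2 : ℝ) (1 / 2)
  · rw [Set.indicator_of_mem hu,
      intervalIntegral.integral_of_le ((arcHeight_le_one u).trans hT),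
      ← integral_Icc_eq_integral_Ioc, ← integral_indicator measurableSet_Icc]
    congr 1
    funext v
    have : (u, v) ∈ fdCoord ∩ {p : ℝ × ℝ | p.2 ≤ T} ↔ v ∈ Set.Icc (arcHeight u) T := by
      rw [Set.mem_inter_iff, mem_fdCoord_iff]
      exact ⟨fun h => ⟨h.1.2, h.2⟩, fun h => ⟨⟨hu, h.1⟩, h.2⟩⟩
    simp only [Set.indicator, this]
  · rw [Set.indicator_of_notMem hu, ← integral_zero ℝ ℂ]
    congr 1
    funext v
    refine Set.indicator_of_notMem (fun h => hu ?_) _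
    exact (mem_fdCoord_iff.1 h.1).1

/-- The fundamental domain lies in a strip `v > 1/2`, over which the bound is integrable. -/
lemma integrableOn_fdCoord {W : ℝ × ℝ → ℂ} (hW : ContinuousOn W {p | 0 < p.2}) {C k δ : ℝ}
    (hδ : 0 < δ)
    (hle : ∀ p ∈ fdCoord, ‖W p‖ ≤ C * (p.2 ^ (-k) * Real.exp (-(δ * p.2)))) :
    IntegrableOn W fdCoord := by
  have hbound : IntegrableOn (fun p : ℝ × ℝ => C * (p.2 ^ (-k) * Real.exp (-(δ * p.2)))) fdCoord := by
    refine IntegrableOn.mono_set ?_ fdCoord_subset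
    rw [IntegrableOn, Measure.volume_eq_prod, ← Measure.prod_restrict]
    exact Integrable.mul_prod (f := fun _ : ℝ => C) (g := fun v : ℝ => v ^ (-k) *
      Real.exp (-(δ * v))) (integrableOn_const (by simp)) (integrableOn_laplaceTail k hδ one_half_pos)
  refine Integrable.mono' hbound ?_ ?_
  · exact (hW.mono fun p hp => hp.1).aestronglyMeasurable measurableSet_fdCoord
  · exact (ae_restrict_mem measurableSet_fdCoord).mono hle

lemma tendsto_integral_truncated {W : ℝ × ℝ → ℂ} (hW : IntegrableOn W fdCoord) :
    Filter.Tendsto (fun N : ℕ => ∫ u in (-1 / 2 : ℝ)..(1 / 2),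
      ∫ v in (arcHeight u)..((N : ℝ) + 1), W (u, v)) Filter.atTop (nhds (∫ p in fdCoord, W p)) := by
  have hunion : ⋃ N : ℕ, fdCoord ∩ {p : ℝ × ℝ | p.2 ≤ (N : ℝ) + 1} = fdCoord := by
    rw [← Set.inter_iUnion, Set.inter_eq_left]
    intro p _
    obtain ⟨N, hN⟩ := exists_nat_ge p.2
    exact Set.mem_iUnion.2 ⟨N, hN.trans (by simp)⟩
  have h := tendsto_setIntegral_of_monotone (μ := volume) (f := W)
    (s := fun N : ℕ => fdCoord ∩ {p : ℝ × ℝ | p.2 ≤ (N : ℝ) + 1})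
    (fun N => measurableSet_fdCoord.inter (measurableSet_le measurable_snd measurable_const))
    (fun M N hMN => Set.inter_subset_inter_right _ fun p hp => by
      have hp : p.2 ≤ (M : ℝ) + 1 := hp
      have : (M : ℝ) ≤ N := by exact_mod_cast hMN
      exact hp.trans (by linarith))
    (by rwa [hunion])
  rw [hunion] at h
  refine h.congr fun N => ?_
  exact setIntegral_fdCoord_inter (by simp) (hW.mono_set Set.inter_subset_left)

/-! ### The pairing -/

namespace EvenLattice

variable {V : Type*} [AddCommGroup V] [Module ℚ V] {L : EvenLattice V} {m : ℤ}
  {g f : ℍ → L.Disc → ℂ}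

lemma differentiableOn_apply (hg : MDifferentiable 𝓘(ℂ) 𝓘(ℂ, L.Disc → ℂ) g) (h : L.Disc) :
    DifferentiableOn ℂ (fun z => g (ofComplex z) h) {z | 0 < z.im} :=
  UpperHalfPlane.mdifferentiable_iff.1 (mdifferentiable_apply hg h)

lemma contDiffOn_apply (hf : ContDiffOn ℝ 2 (f ∘ ofComplex) {z : ℂ | 0 < z.im}) (h : L.Disc) :
    ContDiffOn ℝ 2 (fun z => f (ofComplex z) h) {z | 0 < z.im} :=
  contDiffOn_pi.1 hf h

/-- Unwinding the definition of `ξ_k` turns it into a formula for the antiholomorphic derivative. -/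
lemma IsHPlus.isHPlusComponent (hf : L.IsHPlus m f) {B : L.Disc → ℚ → ℂ}
    (hB : L.neg.IsFourierExpansion (xiOp ((m : ℝ) / 2) f) B) (h : L.Disc) :
    IsHPlusComponent ((m : ℝ) / 2) (L.quad h) (fun τ => f τ h)
      (fun τ => xiOp ((m : ℝ) / 2) f τ h) (B h) where
  contDiffOn := contDiffOn_apply hf.weakMaass.contDiff h
  vadd_one τ := hf.weakMaass.automorphic.apply_T τ h
  dbar z hz := by
    have hd : HasFDerivAt (f ∘ ofComplex) (fderiv ℝ (f ∘ ofComplex) z) z :=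
      ((hf.weakMaass.contDiff.differentiableOn two_ne_zero).differentiableAt
        (isOpen_im_pos.mem_nhds hz)).hasFDerivAt
    have hdh : ∀ w : ℂ, fderiv ℝ ((fun τ => f τ h) ∘ ofComplex) z w =
        fderiv ℝ (f ∘ ofComplex) z w h := fun w => by
      have := (hasFDerivAt_pi'.1 hd h).fderiv
      change fderiv ℝ (fun z => (f ∘ ofComplex) z h) z w = _
      rw [this]
      rfl
    have hcoe : ((ofComplex z : ℍ) : ℂ) = z := by rw [ofComplex_apply_of_im_pos hz]
    have him : (ofComplex z : ℍ).im = z.im := by rw [← coe_im, hcoe]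
    rw [hdh, hdh]
    simp only [xiOp, lowering, partialU, partialV, hcoe, him, map_mul, Complex.conj_conj,
      Complex.conj_ofReal, Pi.smul_apply, Pi.add_apply, smul_eq_mul]
    have hpow : ((z.im ^ (-((m : ℝ) / 2)) : ℝ) : ℂ) * ((z.im ^ ((m : ℝ) / 2 - 2) : ℝ) : ℂ) *
        (z.im : ℂ) ^ 2 = 1 := by
      generalize (m : ℝ) / 2 = k
      have : z.im ^ (-k) * z.im ^ (k - 2) * z.im ^ 2 = 1 := by
        rw [← Real.rpow_natCast z.im 2, ← Real.rpow_add hz, ← Real.rpow_add hz,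
          show -k + (k - 2) + ((2 : ℕ) : ℝ) = 0 by push_cast; ring, Real.rpow_zero]
      exact_mod_cast congrArg ((↑) : ℝ → ℂ) this
    linear_combination (-(fderiv ℝ (f ∘ ofComplex) z 1 h +
      Complex.I * fderiv ℝ (f ∘ ofComplex) z Complex.I h)) * hpow +
      (((z.im ^ (-((m : ℝ) / 2)) : ℝ) : ℂ) * ((z.im ^ ((m : ℝ) / 2 - 2) : ℝ) : ℂ) *
        (z.im : ℂ) ^ 2 * (fderiv ℝ (f ∘ ofComplex) z 1 h +
      Complex.I * fderiv ℝ (f ∘ ofComplex) z Complex.I h)) * Complex.I_mul_I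
  continuous := (mdifferentiable_apply hf.cusp.holo h).continuous
  support := by simpa only [neg_quad] using hB.support h
  hasSum τ := hB.hasSum τ h
  eq_zero n hn := hB.eq_zero_of_nonpos hf.cusp h hn

lemma IsMaassExpansion.isMaassSeries {k : ℝ} {ap am : L.Disc → ℚ → ℂ}
    (h : L.IsMaassExpansion k f ap am) (a : L.Disc) :
    IsMaassSeries k (L.quad a) (fun τ => f τ a) (ap a) (am a) :=
  ⟨h.support_plus a, h.support_minus a, fun τ => h.summable_plus τ a,
    fun τ => h.summable_minus τ a, fun τ => h.eq_add τ a⟩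

lemma IsHPlus.exists_isMaassExpansion (hf : L.IsHPlus m f) :
    ∃ ap am, L.IsMaassExpansion ((m : ℝ) / 2) f ap am := by
  obtain ⟨B, hB⟩ := hf.cusp.isModularForm.exists_isFourierExpansion
  choose ap am h using fun a => (hf.isHPlusComponent hB a).exists_isMaassSeries
  exact ⟨ap, am, fun a => (h a).support_plus, fun a => (h a).support_minus,
    fun τ a => (h a).summable_plus τ, fun τ a => (h a).summable_minus τ, fun τ a => (h a).eq_add τ⟩

lemma IsHPlus.isBigO_apply (hf : L.IsHPlus m f) (a : L.Disc) :
    ∃ C : ℝ, (fun τ => f τ a) =O[atImInfty] fun τ => Real.exp (C * τ.im) := by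
  obtain ⟨C, -, hC⟩ := hf.weakMaass.growth
  exact ⟨C, (isBigO_of_le _ fun τ => norm_le_pi_norm (f τ) a).trans hC⟩

/-- The integrand of the pairing in the coordinates `(u, v)`, with respect to `du dv`. -/
lemma inv_sq_smul_peterssonIntegrand (k : ℝ) (g G : ℍ → L.Disc → ℂ) (u : ℝ) {v : ℝ} (hv : 0 < v) :
    ((v ^ 2)⁻¹ : ℝ) • peterssonIntegrand (2 - k) g G (ofComplex (u + v * Complex.I)) =
      ∑ h, ((v ^ (-k) : ℝ) : ℂ) * (g (ofComplex (u + v * Complex.I)) h *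
        conj (G (ofComplex (u + v * Complex.I)) h)) := by
  rw [peterssonIntegrand, im_ofComplex_add_mul_I u hv, ← Finset.mul_sum, Complex.real_smul]
  have : (v ^ (-k) : ℝ) = (v ^ 2)⁻¹ * v ^ (2 - k) := by
    rw [sub_eq_add_neg, Real.rpow_add hv, Real.rpow_two]
    field_simp
  rw [this]
  push_cast
  ring

lemma integrableOn_fdCoord_peterssonIntegrand {k : ℝ} {K : EvenLattice V} {w : ℤ}
    {g G : ℍ → K.Disc → ℂ} (hg : K.IsModularForm w g) (hG : K.IsCuspForm w G) :
    IntegrableOn (fun p : ℝ × ℝ => ((p.2 ^ 2)⁻¹ : ℝ) •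
      peterssonIntegrand (2 - k) g G (ofComplex (p.1 + p.2 * Complex.I))) fdCoord := by
  have hcongr : Set.EqOn (fun p : ℝ × ℝ => ∑ h, ((p.2 ^ (-k) : ℝ) : ℂ) *
      (g (ofComplex (p.1 + p.2 * Complex.I)) h * conj (G (ofComplex (p.1 + p.2 * Complex.I)) h)))
      (fun p : ℝ × ℝ => ((p.2 ^ 2)⁻¹ : ℝ) •
        peterssonIntegrand (2 - k) g G (ofComplex (p.1 + p.2 * Complex.I))) fdCoord :=
    fun p hp => (inv_sq_smul_peterssonIntegrand k g G p.1 hp.1).symm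
  refine IntegrableOn.congr_fun ?_ hcongr measurableSet_fdCoord
  refine integrable_finsetSum _ fun h _ => ?_
  obtain ⟨C, hC0, hC⟩ := hg.exists_norm_le h
  obtain ⟨C', δ, hC'0, hδ, hC'⟩ := hG.exists_norm_le h
  have hmap : ContinuousOn (fun p : ℝ × ℝ => ofComplex (p.1 + p.2 * Complex.I)) {p | 0 < p.2} :=
    continuousOn_ofComplex.comp (by fun_prop) fun p hp => by simpa using hp
  refine integrableOn_fdCoord (C := C * C') (k := k) ?_ hδ fun p hp => ?_
  · refine ContinuousOn.mul ?_ (ContinuousOn.mul ?_ ?_)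
    · exact Complex.continuous_ofReal.comp_continuousOn
        (continuous_snd.continuousOn.rpow_const fun p hp => Or.inl (ne_of_gt hp))
    · exact (mdifferentiable_apply hg.holo h).continuous.comp_continuousOn hmap
    · exact Complex.continuous_conj.comp_continuousOn
        ((mdifferentiable_apply hG.holo h).continuous.comp_continuousOn hmap)
  · have hv : (1 / 2 : ℝ) ≤ (ofComplex (p.1 + p.2 * Complex.I) : ℍ).im := by
      rw [im_ofComplex_add_mul_I p.1 hp.1]
      exact le_of_lt (fdCoord_subset hp).2
    have h1 := hC _ hv
    have h2 := hC' _ hv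
    rw [im_ofComplex_add_mul_I p.1 hp.1] at h2
    rw [norm_mul, norm_mul, RCLike.norm_conj, Complex.norm_real,
      Real.norm_of_nonneg (Real.rpow_nonneg hp.1.le _)]
    calc p.2 ^ (-k) * (‖g (ofComplex (p.1 + p.2 * Complex.I)) h‖ *
          ‖G (ofComplex (p.1 + p.2 * Complex.I)) h‖)
        ≤ p.2 ^ (-k) * (C * (C' * Real.exp (-(δ * p.2)))) :=
          mul_le_mul_of_nonneg_left (mul_le_mul h1 h2 (norm_nonneg _) hC0)
            (Real.rpow_nonneg hp.1.le _)
      _ = C * C' * (p.2 ^ (-k) * Real.exp (-(δ * p.2))) := by ring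

/-- Stokes' theorem for `∑_h g_h f_h dz`, whose exterior derivative is the integrand of the pairing
up to a constant. -/
lemma integral_truncated_eq (hg : L.neg.IsModularForm (4 - m) g) (hf : L.IsHPlus m f) {T : ℝ}
    (hT : 1 ≤ T) :
    ∫ u in (-1 / 2 : ℝ)..(1 / 2), ∫ v in (arcHeight u)..T, ((v ^ 2)⁻¹ : ℝ) •
      peterssonIntegrand (2 - (m : ℝ) / 2) g (xiOp ((m : ℝ) / 2) f)
        (ofComplex (u + v * Complex.I)) =
      ∫ u in (-1 / 2 : ℝ)..(1 / 2), ∑ h, g (ofComplex (u + T * Complex.I)) h *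
        f (ofComplex (u + T * Complex.I)) h := by
  obtain ⟨B, hB⟩ := hf.cusp.isModularForm.exists_isFourierExpansion
  set k : ℝ := (m : ℝ) / 2 with hk
  set F : ℂ → ℂ := fun z => ∑ h, g (ofComplex z) h * f (ofComplex z) h with hF
  have hgd : ∀ h, DifferentiableOn ℂ (fun z => g (ofComplex z) h) {z | 0 < z.im} := fun h =>
    differentiableOn_apply (L := L.neg) hg.holo h
  have hfd : ∀ h, ContDiffOn ℝ 2 (fun z => f (ofComplex z) h) {z | 0 < z.im} := fun h =>
    contDiffOn_apply hf.weakMaass.contDiff h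
  have hFc : ContDiffOn ℝ 1 F {z | 0 < z.im} := by
    refine ContDiffOn.sum fun h _ => ContDiffOn.mul ?_ ((hfd h).of_le (by norm_num))
    exact ((hgd h).contDiffOn isOpen_im_pos).restrict_scalars ℝ
  have hFT : ∀ z : ℂ, 0 < z.im → F (z + 1) = F z := fun z hz => by
    simp only [hF, ofComplex_add_one hz]
    refine Finset.sum_congr rfl fun h _ => ?_
    have h1 : g ((1 : ℝ) +ᵥ ofComplex z) h = cexp1 (L.neg.quad h) * g (ofComplex z) h :=
      hg.automorphic.apply_T _ _
    rw [h1, hf.weakMaass.automorphic.apply_T, neg_quad]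
    have := cexp1_neg_mul_self (L.quad h)
    push_cast
    linear_combination (g (ofComplex z) h * f (ofComplex z) h) * this
  have hFS : ∀ z : ℂ, 0 < z.im → F (-z⁻¹) = z ^ 2 * F z := fun z hz => by
    have hSz : ofComplex (-z⁻¹) = ModularGroup.S • ofComplex z := by
      rw [UpperHalfPlane.modular_S_smul, ← ofComplex_apply (UpperHalfPlane.mk _ _)]
      congr 1
      rw [ofComplex_apply_of_im_pos hz]
      simp [inv_neg]
    have := hg.automorphic.sum_mul_apply_S hf.weakMaass.automorphic (ofComplex z)
    simp only [hF, hSz]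
    rw [this, ofComplex_apply_of_im_pos hz]
  have hFD : ∀ z : ℂ, 0 < z.im → fderiv ℝ F z 1 + Complex.I * fderiv ℝ F z Complex.I =
      ∑ h, g (ofComplex z) h * (Complex.I * ((z.im ^ (-k) : ℝ) : ℂ) *
        conj (xiOp k f (ofComplex z) h)) := fun z hz => by
    have hgz : ∀ h, HasFDerivAt (fun z => g (ofComplex z) h)
        ((fderiv ℂ (fun z => g (ofComplex z) h) z).restrictScalars ℝ) z := fun h =>
      ((hgd h).differentiableAt (isOpen_im_pos.mem_nhds hz)).hasFDerivAt.restrictScalars ℝ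
    have hfz : ∀ h, HasFDerivAt (fun z => f (ofComplex z) h)
        (fderiv ℝ (fun z => f (ofComplex z) h) z) z := fun h =>
      (((hfd h).differentiableOn two_ne_zero).differentiableAt
        (isOpen_im_pos.mem_nhds hz)).hasFDerivAt
    have hd := HasFDerivAt.fun_sum (u := Finset.univ) fun h _ => (hgz h).fun_mul (hfz h)
    rw [show F = fun z => ∑ h, g (ofComplex z) h * f (ofComplex z) h from rfl, hd.fderiv]
    simp only [sum_apply, add_apply, smul_apply,
      ContinuousLinearMap.coe_restrictScalars', smul_eq_mul]
    rw [Finset.mul_sum, ← Finset.sum_add_distrib]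
    refine Finset.sum_congr rfl fun h _ => ?_
    have hlin : fderiv ℂ (fun z => g (ofComplex z) h) z Complex.I =
        Complex.I * fderiv ℂ (fun z => g (ofComplex z) h) z 1 := by
      rw [← smul_eq_mul, ← map_smul, smul_eq_mul, mul_one]
    rw [hlin, ← (hf.isHPlusComponent hB h).dbar z hz]
    simp only [Function.comp_def]
    linear_combination (f (ofComplex z) h * fderiv ℂ (fun z => g (ofComplex z) h) z 1) *
      Complex.I_mul_I
  have hstokes := integral_truncated_fundamentalDomain hFc hFT hFS hFD hT
  rw [← neg_inj, ← hstokes, ← intervalIntegral.integral_neg]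
  refine intervalIntegral.integral_congr fun u hu => ?_
  rw [Set.uIcc_of_le (by norm_num)] at hu
  rw [← intervalIntegral.integral_neg]
  refine intervalIntegral.integral_congr fun v hv => ?_
  rw [Set.uIcc_of_le ((arcHeight_le_one u).trans hT)] at hv
  have hv0 : 0 < v := (arcHeight_pos hu).trans_le hv.1
  rw [inv_sq_smul_peterssonIntegrand k g (xiOp k f) u hv0, im_add_mul_I, Finset.mul_sum,
    ← Finset.sum_neg_distrib]
  refine Finset.sum_congr rfl fun h _ => ?_
  linear_combination (-(((v ^ (-k) : ℝ) : ℂ) * (g (ofComplex (u + v * Complex.I)) h *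
    conj (xiOp k f (ofComplex (u + v * Complex.I)) h)))) * Complex.I_mul_I

/-- Both sides are the limit, as the height of the truncation tends to infinity, of the two sides of
`integral_truncated_eq`. -/
lemma maassPairing_eq (hm : m ≠ 2) (hg : L.neg.IsModularForm (4 - m) g) (hf : L.IsHPlus m f)
    {b ap am : L.Disc → ℚ → ℂ} (hb : L.neg.IsFourierExpansion g b)
    (hM : L.IsMaassExpansion ((m : ℝ) / 2) f ap am) :
    maassPairing ((m : ℝ) / 2) g f = ∑ h, ∑ᶠ n ∈ Set.Iic (0 : ℚ), ap h n * b h (-n) := by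
  obtain ⟨B, hB⟩ := hf.cusp.isModularForm.exists_isFourierExpansion
  have hk : (m : ℝ) / 2 ≠ 1 := fun h => hm (by
    have : (m : ℝ) = 2 := by linarith
    exact_mod_cast this)
  have hint := integrableOn_fdCoord_peterssonIntegrand (K := L.neg) (k := (m : ℝ) / 2) hg hf.cusp
  have h1 := tendsto_integral_truncated hint
  have h2 : Filter.Tendsto (fun T : ℝ => ∑ h, ∫ u in (-1 / 2 : ℝ)..(1 / 2),
      g (ofComplex (u + T * Complex.I)) h * f (ofComplex (u + T * Complex.I)) h) Filter.atTop
      (nhds (∑ h, ∑ᶠ n ∈ Set.Iic (0 : ℚ), ap h n * b h (-n))) := by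
    refine tendsto_finsetSum _ fun h _ => ?_
    obtain ⟨C, hC⟩ := hf.isBigO_apply h
    have hsupp : ∀ n, b h n ≠ 0 → ∃ j : ℤ, n - -L.quad h = j := by
      simpa only [neg_quad] using hb.support h
    have hsum : ∀ τ : ℍ, HasSum (fun n : ℚ => b h n * cexp1 (n * (τ : ℂ))) (g τ h) :=
      fun τ => hb.hasSum τ h
    have hneg : ∀ n < 0, b h n = 0 := fun n hn => hb.eq_zero_of_neg hg h hn
    have hfin : {n : ℚ | n ≤ 0 ∧ ap h n ≠ 0}.Finite :=
      (hM.isMaassSeries h).finite_principalPart hC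
    have key := tendsto_integral_mul (hf.isHPlusComponent hB h) (hM.isMaassSeries h) hk hfin
      hsupp hsum hneg
    exact key
  have h3 := h2.comp (Filter.tendsto_atTop_add_const_right _ (1 : ℝ) tendsto_natCast_atTop_atTop)
  rw [maassPairing, peterssonProduct, (integrableOn_fd_and_setIntegral_fd _).2]
  refine tendsto_nhds_unique h1 (h3.congr fun N => ?_)
  have hN : (0 : ℝ) < (N : ℝ) + 1 := by positivity
  rw [Function.comp_apply]
  refine Eq.trans ?_ (integral_truncated_eq hg hf (T := (N : ℝ) + 1) (by simp)).symm
  rw [intervalIntegral.integral_finsetSum]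
  intro h _
  refine Continuous.intervalIntegrable ?_ _ _
  have hline : Continuous fun u : ℝ => ofComplex (u + ((N : ℝ) + 1 : ℝ) * Complex.I) :=
    continuousOn_ofComplex.comp_continuous (by fun_prop) fun u => by simpa using hN
  refine ((mdifferentiable_apply (K := L.neg) hg.holo h).continuous.comp hline).mul ?_
  exact (contDiffOn_apply hf.weakMaass.contDiff h).continuousOn.comp_continuous (by fun_prop)
    fun u => by simpa using hN

end EvenLattice

theorem mainTheorem11 {V : Type*} [AddCommGroup V] [Module ℚ V] (L : EvenLattice V)
    (m : ℤ) (hm : m ≠ 2) (g f : ℍ → L.Disc → ℂ)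
    (hg : L.neg.IsModularForm (4 - m) g) (hf : L.IsHPlus m f) :
    (∃ b, L.neg.IsFourierExpansion g b) ∧
    (∃ ap am, L.IsMaassExpansion ((m : ℝ) / 2) f ap am) ∧
    IntegrableOn (peterssonIntegrand (2 - (m : ℝ) / 2) g (xiOp ((m : ℝ) / 2) f)) 𝒟 ∧
    ∀ b ap am : L.Disc → ℚ → ℂ, L.neg.IsFourierExpansion g b →
      L.IsMaassExpansion ((m : ℝ) / 2) f ap am →
      (∀ h, {n : ℚ | n ≤ 0 ∧ ap h n ≠ 0}.Finite) ∧
      maassPairing ((m : ℝ) / 2) g f = ∑ h, ∑ᶠ n ∈ Set.Iic (0 : ℚ), ap h n * b h (-n) ∧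
      ∀ (f' : ℍ → L.Disc → ℂ) (ap' am' : L.Disc → ℚ → ℂ), L.IsHPlus m f' →
        L.IsMaassExpansion ((m : ℝ) / 2) f' ap' am' →
        (∀ h, ∀ n ≤ 0, ap' h n = ap h n) →
        maassPairing ((m : ℝ) / 2) g f' = maassPairing ((m : ℝ) / 2) g f := by
  have hfin : ∀ {ap am : L.Disc → ℚ → ℂ}, L.IsMaassExpansion ((m : ℝ) / 2) f ap am →
      ∀ h, {n : ℚ | n ≤ 0 ∧ ap h n ≠ 0}.Finite := fun hM h => by
    obtain ⟨C, hC⟩ := hf.isBigO_apply h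
    exact (hM.isMaassSeries h).finite_principalPart hC
  refine ⟨hg.exists_isFourierExpansion, hf.exists_isMaassExpansion,
    (integrableOn_fd_and_setIntegral_fd _).1.2
      (EvenLattice.integrableOn_fdCoord_peterssonIntegrand (K := L.neg) hg hf.cusp),
    fun b ap am hb hM => ⟨hfin hM, EvenLattice.maassPairing_eq hm hg hf hb hM,
      fun f' ap' am' hf' hM' heq => ?_⟩⟩
  rw [EvenLattice.maassPairing_eq hm hg hf hb hM, EvenLattice.maassPairing_eq hm hg hf' hb hM']
  refine Finset.sum_congr rfl fun h _ => finsum_congr fun n => finsum_congr fun hn => ?_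
  rw [heq h n hn]
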